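/- Let $d\ge 1$, let $\nu\in\mathbb{R}^d$ be a unit vector, and let $w:\mathbb{R}^d\to[0,\infty)$ be a radial kernel with $w\in L^1_{\mathrm{loc}}(\mathbb{R}^d\setminus\{0\})$, $\int_{\mathbb{R}^d}\min(1,|x|)\,w(x)\,dx<\infty$, and $w(x)>0$ for $0<|x|\le\epsilon_0$, for some $\epsilon_0\in(0,1)$. Let $\chi_{\nu}$ be the indicator function of $\{z\in\mathbb{R}^d: z\cdot\nu\ge 0\}$. For $\phi\in C_c^\infty(\mathbb{R}^d;\mathbb{R}^d)$ put $$\mathcal{D}_w^{-\nu}\phi(x)=\lim_{\epsilon\to0^+}\int_{\mathbb{R}^d\setminus B_\epsilon(x)}\chi_{-\nu}(y-x)\,\frac{y-x}{|y-x|}\cdot(\phi(y)-\phi(x))\,w(y-x)\,dy .$$ For $u\in L^2(\mathbb{R}^d)$ the distributional nonlocal gradient $\mathfrak{G}_w^\nu u$ is given by $\langle\mathfrak{G}_w^\nu u,\phi\rangle=-\int_{\mathbb{R}^d}u\,\mathcal{D}_w^{-\nu}\phi\,dx$ for $\phi\in C_c^\infty(\mathbb{R}^d;\mathbb{R}^d)$.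 For a domain (open connected set) $\Omega\subset\mathbb{R}^d$ let $$\mathcal{S}_w^\nu(\Omega)=\{u\in L^2(\mathbb{R}^d): u=0\text{ a.e. on }\mathbb{R}^d\setminus\Omega,\ \mathfrak{G}_w^\nu u\in L^2(\mathbb{R}^d;\mathbb{R}^d)\},\qquad \|u\|_{\mathcal{S}_w^\nu(\Omega)}=\left(\|u\|_{L^2}^2+\|\mathfrak{G}_w^\nu u\|_{L^2}^2\right)^{1/2}.$$ Call $\Omega$ an epigraph if, up to a rigid motion (an isometry of $\mathbb{R}^d$), $\Omega=\{x=(x',x_d): x_d>\zeta(x')\}$ for a continuous function $\zeta:\mathbb{R}^{d-1}\to\mathbb{R}$. Say that $\Omega$ has a continuous boundary if for every $x_0\in\partial\Omega$ there are $r>0$ and an epigraph $E$ with $\Omega\cap B_r(x_0)=E\cap B_r(x_0)$. **Theorem.** Let $\Omega$ be a bounded domain with a continuous boundary, an epigraph, or $\mathbb{R}^d$. Let $C_c^\infty(\Omega)$ denote the space of smooth real-valued functions on $\mathbb{R}^d$ with compact support contained in $\Omega$. Then $C_c^\infty(\Omega)\subset\mathcal{S}_w^\nu(\Omega)$, and $C_c^\infty(\Omega)$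 is dense in $\mathcal{S}_w^\nu(\Omega)$ with respect to $\|\cdot\|_{\mathcal{S}_w^\nu(\Omega)}$. -/

import Mathlib

open MeasureTheory Filter Topology
open scoped ContDiff

noncomputable section

namespace HalfBall

/-- The Euclidean space `ℝ^d`. -/
abbrev Rd (d : ℕ) : Type := EuclideanSpace ℝ (Fin d)

/-- The standing assumptions on the kernel `w`: it is locally integrable away from the origin,
nonnegative and radial, positive on a punctured ball around the origin, and
`∫ min (1, |x|) w(x) dx < ∞`. -/
structure Kernel (d : ℕ) where
  /-- the kernel function `w` -/
  toFun : Rd d → ℝ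
  locallyIntegrableOn : LocallyIntegrableOn toFun {0}ᶜ
  nonneg : ∀ x, 0 ≤ toFun x
  radial : ∀ x y, ‖x‖ = ‖y‖ → toFun x = toFun y
  pos_near_zero : ∃ ε₀ : ℝ, 0 < ε₀ ∧ ε₀ < 1 ∧ ∀ x, 0 < ‖x‖ → ‖x‖ ≤ ε₀ → 0 < toFun x
  integrable : Integrable (fun x => min 1 ‖x‖ * toFun x)

/-- The characteristic function `χ_ν` of the half-space `{z : z ⬝ ν ≥ 0}`. -/
def halfSpaceChar {d : ℕ} (ν : Rd d) : Rd d → ℝ :=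
  {z | 0 ≤ inner ℝ z ν}.indicator 1

/-- The nonlocal half-ball divergence of a vector field `v` on `ℝ^d`, in the principal value sense:
`lim_{ε → 0⁺} ∫_{ℝ^d ∖ B_ε(x)} χ_ν(y - x) ((y - x) / |y - x|) ⬝ (v(y) - v(x)) w(y - x) dy`. -/
def divergence {d : ℕ} (w : Kernel d) (ν : Rd d) (v : Rd d → Rd d) (x : Rd d) : ℝ :=
  limUnder (𝓝[>] (0 : ℝ)) fun ε =>
    ∫ y in (Metric.ball x ε)ᶜ,
      halfSpaceChar ν (y - x) * inner ℝ (‖y - x‖⁻¹ • (y - x)) (v y - v x) * w.toFun (y - x)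

/-- The pairing `⟨𝔊u, φ⟩ = - ∫ u(x) (D^{-ν} φ)(x) dx` of the distributional nonlocal gradient of
`u` with a vector field `φ`. -/
def distGradPairing {d : ℕ} (w : Kernel d) (ν : Rd d) (u : Rd d → ℝ) (φ : Rd d → Rd d) : ℝ :=
  -∫ x, u x * divergence w (-ν) φ x

/-- The distributional nonlocal gradient of `u` is the vector field `g`: it acts on all
`φ ∈ C_c^∞(ℝ^d; ℝ^d)` as integration against `g`. -/
def HasDistGrad {d : ℕ} (w : Kernel d) (ν : Rd d) (u : Rd d → ℝ) (g : Rd d → Rd d) : Prop :=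
  ∀ φ : Rd d → Rd d, ContDiff ℝ ∞ φ → HasCompactSupport φ →
    distGradPairing w ν u φ = ∫ x, inner ℝ (g x) (φ x)

/-! ### The divergence of a test field is square integrable -/

section DivergenceL2

variable {d : ℕ} (w : Kernel d) (ν : Rd d) (v : Rd d → Rd d)

/-- The weighted difference quotient occurring in the divergence. -/
def quot (x z : Rd d) : ℝ :=
  halfSpaceChar ν z * inner ℝ (‖z‖⁻¹ • z) (v (x + z) - v x) * (min 1 ‖z‖)⁻¹

/-- The integrable weight `min (1, |z|) w(z)`. -/
def weight (z : Rd d) : ℝ := min 1 ‖z‖ * w.toFun z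

lemma quot_mul_weight (x z : Rd d) :
    halfSpaceChar ν z * inner ℝ (‖z‖⁻¹ • z) (v (x + z) - v x) * w.toFun z
      = quot ν v x z * weight w z := by
  by_cases hz : z = 0
  · simp [hz, quot]
  · have : min 1 ‖z‖ ≠ 0 := (lt_min one_pos (norm_pos_iff.2 hz)).ne'
    simp only [quot, weight]
    field_simp

lemma weight_nonneg (z : Rd d) : 0 ≤ weight w z :=
  mul_nonneg (le_min zero_le_one (norm_nonneg _)) (w.nonneg z)

lemma measurable_quot (hv : Continuous v) :
    Measurable (fun p : Rd d × Rd d => quot ν v p.1 p.2) := by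
  have h1 : Measurable (halfSpaceChar ν) :=
    measurable_one.indicator
      (isClosed_le continuous_const (by fun_prop)).measurableSet
  have h2 : Measurable fun p : Rd d × Rd d => v (p.1 + p.2) - v p.1 :=
    (Continuous.measurable (by fun_prop))
  have h3 : Measurable fun p : Rd d × Rd d => ‖p.2‖⁻¹ • p.2 := by fun_prop
  have h4 : Measurable fun p : Rd d × Rd d => (min 1 ‖p.2‖)⁻¹ := by fun_prop
  exact ((h1.comp measurable_snd).mul (h3.inner h2)).mul h4

lemma exists_quot_bound (hv : ContDiff ℝ ∞ v) (hc : HasCompactSupport v) :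
    ∃ C : ℝ, 0 ≤ C ∧ ∀ x z, |quot ν v x z| ≤ C := by
  obtain ⟨L, hL⟩ := ContDiff.lipschitzWith_of_hasCompactSupport hc hv (by simp)
  obtain ⟨M, hM⟩ := hc.exists_bound_of_continuous hv.continuous
  have hM0 : 0 ≤ M := (norm_nonneg _).trans (hM 0)
  refine ⟨L + 2 * M, by positivity, fun x z => ?_⟩
  by_cases hz : z = 0
  · simp only [quot, hz, norm_zero, inv_zero, zero_smul, inner_zero_left, mul_zero, zero_mul,
      abs_zero]
    positivity
  have hzn : 0 < ‖z‖ := norm_pos_iff.2 hz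
  have hm : 0 < min 1 ‖z‖ := lt_min one_pos hzn
  have hchi : |halfSpaceChar ν z| ≤ 1 := by
    unfold halfSpaceChar
    by_cases h : z ∈ {z : Rd d | 0 ≤ inner ℝ z ν}
    · rw [Set.indicator_of_mem h]; simp
    · rw [Set.indicator_of_notMem h]; simp
  have hdiff : ‖v (x + z) - v x‖ ≤ (L + 2 * M) * min 1 ‖z‖ := by
    have h1 : ‖v (x + z) - v x‖ ≤ L * ‖z‖ := by
      have := hL.dist_le_mul (x + z) x
      simpa [dist_eq_norm] using this
    have h2 : ‖v (x + z) - v x‖ ≤ 2 * M := by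
      have := norm_sub_le (v (x + z)) (v x)
      linarith [hM (x + z), hM x]
    have hL0 : (0 : ℝ) ≤ L := L.2
    rcases min_cases 1 ‖z‖ with ⟨h, h'⟩ | ⟨h, h'⟩ <;> rw [h]
    · linarith
    · nlinarith
  have hin : |inner ℝ (‖z‖⁻¹ • z) (v (x + z) - v x)| ≤ (L + 2 * M) * min 1 ‖z‖ := by
    refine (abs_real_inner_le_norm _ _).trans ?_
    rw [norm_smul, norm_inv, norm_norm, inv_mul_cancel₀ hzn.ne', one_mul]
    exact hdiff
  unfold quot
  rw [abs_mul, abs_mul, abs_of_pos (inv_pos.2 hm), ← div_eq_mul_inv, div_le_iff₀ hm]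
  calc _ ≤ 1 * |inner ℝ (‖z‖⁻¹ • z) (v (x + z) - v x)| := by gcongr
    _ ≤ _ := by rw [one_mul]; exact hin

lemma quot_eq_zero {x z : Rd d} (h1 : x ∉ tsupport v) (h2 : x + z ∉ tsupport v) :
    quot ν v x z = 0 := by
  simp [quot, image_eq_zero_of_notMem_tsupport h1, image_eq_zero_of_notMem_tsupport h2]

lemma integrable_quot_weight (hv : ContDiff ℝ ∞ v) (hc : HasCompactSupport v) (x : Rd d) :
    Integrable (fun z => quot ν v x z * weight w z) := by
  obtain ⟨C, -, hC⟩ := exists_quot_bound ν v hv hc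
  exact w.integrable.bdd_mul (c := C)
    ((measurable_quot ν v hv.continuous).comp measurable_prodMk_left).aestronglyMeasurable
    (Eventually.of_forall fun z => hC x z)

/-- On a test field the principal value is an absolutely convergent integral. -/
lemma tendsto_divergence (hv : ContDiff ℝ ∞ v) (hc : HasCompactSupport v) (x : Rd d) :
    Tendsto (fun ε : ℝ => ∫ y in (Metric.ball x ε)ᶜ,
      halfSpaceChar ν (y - x) * inner ℝ (‖y - x‖⁻¹ • (y - x)) (v y - v x) * w.toFun (y - x))
      (𝓝[>] 0) (𝓝 (∫ z, quot ν v x z * weight w z)) := by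
  have key : ∀ y, halfSpaceChar ν (y - x) * inner ℝ (‖y - x‖⁻¹ • (y - x)) (v y - v x)
      * w.toFun (y - x) = quot ν v x (y - x) * weight w (y - x) := fun y => by
    rw [← quot_mul_weight, add_sub_cancel]
  simp only [key]
  rw [← integral_sub_right_eq_self (fun z => quot ν v x z * weight w z) x]
  have hint : Integrable (fun y => quot ν v x (y - x) * weight w (y - x)) :=
    (integrable_quot_weight w ν v hv hc x).comp_sub_right x
  simp only [← integral_indicator Metric.isOpen_ball.measurableSet.compl]
  refine tendsto_integral_filter_of_dominated_convergence _ ?_ ?_ hint.norm ?_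
  · exact Eventually.of_forall fun ε =>
      hint.aestronglyMeasurable.indicator Metric.isOpen_ball.measurableSet.compl
  · exact Eventually.of_forall fun ε => Eventually.of_forall fun y => norm_indicator_le_norm_self _ _
  · refine Eventually.of_forall fun y => ?_
    by_cases hy : y = x
    · have h0 : quot ν v x (y - x) * weight w (y - x) = 0 := by simp [hy, quot]
      refine tendsto_const_nhds.congr fun ε => ?_
      by_cases h : y ∈ (Metric.ball x ε)ᶜ
      · rw [Set.indicator_of_mem h]
      · rw [Set.indicator_of_notMem h, h0]
    · refine tendsto_const_nhds.congr' ?_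
      have : ∀ᶠ ε : ℝ in 𝓝[>] 0, ε < dist y x :=
        nhdsWithin_le_nhds (Iio_mem_nhds (dist_pos.2 hy))
      filter_upwards [this] with ε hε
      rw [Set.indicator_of_mem]
      simpa using hε.le

lemma divergence_eq (hv : ContDiff ℝ ∞ v) (hc : HasCompactSupport v) (x : Rd d) :
    divergence w ν v x = ∫ z, quot ν v x z * weight w z :=
  (tendsto_divergence w ν v hv hc x).limUnder_eq

lemma integrable_prod (hv : ContDiff ℝ ∞ v) (hc : HasCompactSupport v) :
    Integrable (fun p : Rd d × Rd d => quot ν v p.1 p.2 * weight w p.2)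
      (volume.prod volume) := by
  obtain ⟨C, hC0, hC⟩ := exists_quot_bound ν v hv hc
  let f : Rd d → ℝ := (tsupport v).indicator 1
  have hf : Integrable f :=
    (integrable_indicator_iff (isClosed_tsupport v).measurableSet).2
      (integrableOn_const (hc.isCompact.measure_lt_top.ne))
  have hfm : Measurable f := measurable_one.indicator (isClosed_tsupport v).measurableSet
  have hf0 : ∀ x, 0 ≤ f x := fun x => Set.indicator_nonneg (by simp) x
  have h1 : Integrable (fun p : Rd d × Rd d => f p.1 * weight w p.2) (volume.prod volume) :=
    hf.mul_prod w.integrable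
  have hmp : MeasurePreserving (fun p : Rd d × Rd d => (p.1 + p.2, p.2))
      (volume.prod volume) (volume.prod volume) :=
    measurePreserving_add_prod volume volume
  have h2 : Integrable (fun p : Rd d × Rd d => f (p.1 + p.2) * weight w p.2)
      (volume.prod volume) := hmp.integrable_comp_of_integrable h1
  refine ((h1.add h2).const_mul C).mono' ?_ (Eventually.of_forall fun p => ?_)
  · exact (measurable_quot ν v hv.continuous).aestronglyMeasurable.mul
      (w.integrable.aestronglyMeasurable.comp_snd)
  · rw [Real.norm_eq_abs, abs_mul, abs_of_nonneg (weight_nonneg w p.2)]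
    simp only [Pi.add_apply]
    rw [← add_mul, ← mul_assoc]
    refine mul_le_mul_of_nonneg_right ?_ (weight_nonneg w p.2)
    by_cases ha : p.1 ∈ tsupport v
    · have : f p.1 = 1 := by simp [f, ha]
      nlinarith [hC p.1 p.2, hf0 (p.1 + p.2)]
    · by_cases hb : p.1 + p.2 ∈ tsupport v
      · have : f (p.1 + p.2) = 1 := by simp [f, hb]
        nlinarith [hC p.1 p.2, hf0 p.1]
      · rw [quot_eq_zero ν v ha hb, abs_zero]
        exact mul_nonneg hC0 (add_nonneg (hf0 _) (hf0 _))

lemma memLp_divergence (hv : ContDiff ℝ ∞ v) (hc : HasCompactSupport v) :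
    MemLp (divergence w ν v) 2 := by
  obtain ⟨C, hC0, hC⟩ := exists_quot_bound ν v hv hc
  have hi : Integrable (divergence w ν v) := by
    have := (integrable_prod w ν v hv hc).integral_prod_left
    simpa only [← divergence_eq w ν v hv hc] using this
  have hb : ∀ x, ‖divergence w ν v x‖ ≤ C * ∫ z, weight w z := fun x => by
    rw [divergence_eq w ν v hv hc, ← integral_const_mul]
    refine norm_integral_le_of_norm_le (w.integrable.const_mul C) (Eventually.of_forall fun z => ?_)
    rw [Real.norm_eq_abs, abs_mul, abs_of_nonneg (weight_nonneg w z)]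
    exact mul_le_mul_of_nonneg_right (hC x z) (weight_nonneg w z)
  rw [memLp_two_iff_integrable_sq hi.aestronglyMeasurable]
  simp only [sq]
  exact hi.bdd_mul hi.aestronglyMeasurable (Eventually.of_forall hb)

end DivergenceL2

/-! ### The nonlocal Sobolev space -/

section Space

variable {d : ℕ}

lemma HasDistGrad.add {w : Kernel d} {ν : Rd d} {u v : Lp ℝ 2 (volume : Measure (Rd d))}
    {g h : Lp (Rd d) 2 (volume : Measure (Rd d))} (hu : HasDistGrad w ν u g)
    (hv : HasDistGrad w ν v h) : HasDistGrad w ν (u + v : Lp ℝ 2 volume) (g + h : Lp _ 2 volume) := by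
  intro φ h1 h2
  have hD := memLp_divergence w (-ν) φ h1 h2
  have hφ : MemLp φ 2 := h1.continuous.memLp_of_hasCompactSupport h2
  have e1 : ∫ x, (u + v : Lp ℝ 2 volume) x * divergence w (-ν) φ x
      = (∫ x, u x * divergence w (-ν) φ x) + ∫ x, v x * divergence w (-ν) φ x := by
    have hu' : Integrable fun x => u x * divergence w (-ν) φ x := (Lp.memLp u).integrable_mul hD
    have hv' : Integrable fun x => v x * divergence w (-ν) φ x := (Lp.memLp v).integrable_mul hD
    rw [← integral_add hu' hv']
    refine integral_congr_ae ?_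
    filter_upwards [Lp.coeFn_add u v] with x hx
    rw [hx, Pi.add_apply, add_mul]
  have hin : ∀ k : Lp (Rd d) 2 (volume : Measure (Rd d)),
      Integrable (fun x => inner ℝ (k x) (φ x)) := fun k => by
    refine (L2.integrable_inner (𝕜 := ℝ) k (hφ.toLp φ)).congr ?_
    filter_upwards [hφ.coeFn_toLp] with x hx
    rw [hx]
  have e2 : ∫ x, inner ℝ ((g + h : Lp (Rd d) 2 volume) x) (φ x)
      = (∫ x, inner ℝ (g x) (φ x)) + ∫ x, inner ℝ (h x) (φ x) := by
    rw [← integral_add (hin g) (hin h)]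
    refine integral_congr_ae ?_
    filter_upwards [Lp.coeFn_add g h] with x hx
    rw [hx, Pi.add_apply, inner_add_left]
  have a := hu φ h1 h2
  have b := hv φ h1 h2
  unfold distGradPairing at a b ⊢
  rw [e1, e2, ← a, ← b]
  ring

lemma HasDistGrad.smul {w : Kernel d} {ν : Rd d} {u : Lp ℝ 2 (volume : Measure (Rd d))}
    {g : Lp (Rd d) 2 (volume : Measure (Rd d))} (c : ℝ) (hu : HasDistGrad w ν u g) :
    HasDistGrad w ν (c • u : Lp ℝ 2 volume) (c • g : Lp _ 2 volume) := by
  intro φ h1 h2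
  have e1 : ∫ x, (c • u : Lp ℝ 2 volume) x * divergence w (-ν) φ x
      = c * ∫ x, u x * divergence w (-ν) φ x := by
    rw [← integral_const_mul]
    refine integral_congr_ae ?_
    filter_upwards [Lp.coeFn_smul c u] with x hx
    simp [hx, mul_assoc]
  have e2 : ∫ x, inner ℝ ((c • g : Lp (Rd d) 2 volume) x) (φ x)
      = c * ∫ x, inner ℝ (g x) (φ x) := by
    rw [← integral_const_mul]
    refine integral_congr_ae ?_
    filter_upwards [Lp.coeFn_smul c g] with x hx
    simp [hx, inner_smul_left]
  have a := hu φ h1 h2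
  unfold distGradPairing at a ⊢
  rw [e1, e2, ← a]
  ring

/-- The distributional gradient in `L²` is unique. -/
lemma HasDistGrad.unique {w : Kernel d} {ν : Rd d} {u : Rd d → ℝ}
    {g h : Lp (Rd d) 2 (volume : Measure (Rd d))} (hg : HasDistGrad w ν u g)
    (hh : HasDistGrad w ν u h) : g = h := by
  have hloc : LocallyIntegrable (g : Rd d → Rd d) :=
    (Lp.memLp g).locallyIntegrable (by norm_num)
  have hloc' : LocallyIntegrable (h : Rd d → Rd d) :=
    (Lp.memLp h).locallyIntegrable (by norm_num)
  refine Lp.ext (ae_eq_of_integral_contDiff_smul_eq hloc hloc' fun ψ h1 h2 => ?_)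
  have hi : ∀ k : Lp (Rd d) 2 (volume : Measure (Rd d)), Integrable fun x => ψ x • k x := fun k =>
    ((Lp.memLp k).locallyIntegrable (by norm_num)).integrable_smul_left_of_hasCompactSupport
      h1.continuous h2
  refine ext_inner_left ℝ fun c => ?_
  rw [← integral_inner (hi g), ← integral_inner (hi h)]
  have a := hg (fun x => ψ x • c) (h1.smul contDiff_const) h2.smul_right
  rw [hh (fun x => ψ x • c) (h1.smul contDiff_const) h2.smul_right] at a
  simp only [inner_smul_right] at a ⊢
  simp only [real_inner_comm c] at a ⊢
  exact a.symm

/-- The set of all `u ∈ L²(ℝ^d)` that vanish a.e. outside `Ω` and whose distributional nonlocal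
gradient is in `L²(ℝ^d; ℝ^d)`, as a linear subspace of `L²(ℝ^d)`. -/
def sobolevSubmodule (w : Kernel d) (ν : Rd d) (Ω : Set (Rd d)) :
    Submodule ℝ (Lp ℝ 2 (volume : Measure (Rd d))) where
  carrier := {u | (∀ᵐ x, x ∉ Ω → u x = 0) ∧
    ∃ g : Lp (Rd d) 2 (volume : Measure (Rd d)), HasDistGrad w ν u g}
  zero_mem' := by
    refine ⟨?_, 0, fun φ _ _ => ?_⟩
    · exact (Lp.coeFn_zero ℝ 2 (volume : Measure (Rd d))).mono fun x hx _ => hx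
    · have e1 : ∫ x, (0 : Lp ℝ 2 (volume : Measure (Rd d))) x * divergence w (-ν) φ x = 0 := by
        refine integral_eq_zero_of_ae ?_
        filter_upwards [Lp.coeFn_zero ℝ 2 (volume : Measure (Rd d))] with x hx
        rw [hx]; simp
      have e2 : ∫ x, inner ℝ ((0 : Lp (Rd d) 2 (volume : Measure (Rd d))) x) (φ x) = 0 := by
        refine integral_eq_zero_of_ae ?_
        filter_upwards [Lp.coeFn_zero (Rd d) 2 (volume : Measure (Rd d))] with x hx
        rw [hx]; simp
      rw [distGradPairing, e1, e2, neg_zero]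
  add_mem' := by
    rintro u v ⟨hu, g, hg⟩ ⟨hv, h, hh⟩
    refine ⟨?_, g + h, hg.add hh⟩
    filter_upwards [hu, hv, Lp.coeFn_add u v] with x h1 h2 h3 hx
    rw [h3, Pi.add_apply, h1 hx, h2 hx, add_zero]
  smul_mem' := by
    rintro c u ⟨hu, g, hg⟩
    refine ⟨?_, c • g, hg.smul c⟩
    filter_upwards [hu, Lp.coeFn_smul c u] with x h1 h3 hx
    simp [h3, h1 hx]

/-- The nonlocal Sobolev space `S_w^ν(Ω)`. It is a separate type because it carries its own norm,
not the one inherited from `L²(ℝ^d)`. -/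
def Sobolev (w : Kernel d) (ν : Rd d) (Ω : Set (Rd d)) : Type :=
  sobolevSubmodule w ν Ω

namespace Sobolev

variable (w : Kernel d) (ν : Rd d) (Ω : Set (Rd d))

instance : AddCommGroup (Sobolev w ν Ω) :=
  inferInstanceAs (AddCommGroup (sobolevSubmodule w ν Ω))

instance : Module ℝ (Sobolev w ν Ω) :=
  inferInstanceAs (Module ℝ (sobolevSubmodule w ν Ω))

/-- The inclusion of `S_w^ν(Ω)` into `L²(ℝ^d)`. -/
def toL2 : Sobolev w ν Ω →ₗ[ℝ] Lp ℝ 2 (volume : Measure (Rd d)) :=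
  (sobolevSubmodule w ν Ω).subtype

lemma exists_grad (u : Sobolev w ν Ω) :
    ∃ g : Lp (Rd d) 2 (volume : Measure (Rd d)), HasDistGrad w ν (toL2 w ν Ω u) g :=
  u.2.2

/-- The distributional nonlocal gradient, as a linear map from `S_w^ν(Ω)` to `L²(ℝ^d; ℝ^d)`. -/
def grad : Sobolev w ν Ω →ₗ[ℝ] Lp (Rd d) 2 (volume : Measure (Rd d)) where
  toFun u := (exists_grad w ν Ω u).choose
  map_add' u v := HasDistGrad.unique (u := toL2 w ν Ω (u + v)) (exists_grad w ν Ω (u + v)).choose_spec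
    (by rw [map_add]
        exact (exists_grad w ν Ω u).choose_spec.add (exists_grad w ν Ω v).choose_spec)
  map_smul' c u := HasDistGrad.unique (u := toL2 w ν Ω (c • u)) (exists_grad w ν Ω (c • u)).choose_spec
    (by rw [map_smul]
        exact (exists_grad w ν Ω u).choose_spec.smul c)

lemma hasDistGrad_grad (u : Sobolev w ν Ω) :
    HasDistGrad w ν (toL2 w ν Ω u) (grad w ν Ω u) :=
  (exists_grad w ν Ω u).choose_spec

/-- The linear map `u ↦ (u, 𝔊u)` into the Hilbert space `L²(ℝ^d) × L²(ℝ^d; ℝ^d)`. -/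
def graphMap : Sobolev w ν Ω →ₗ[ℝ]
    WithLp 2 (Lp ℝ 2 (volume : Measure (Rd d)) × Lp (Rd d) 2 (volume : Measure (Rd d))) :=
  (WithLp.linearEquiv 2 ℝ _).symm.toLinearMap ∘ₗ (toL2 w ν Ω).prod (grad w ν Ω)

lemma graphMap_injective : Function.Injective (graphMap w ν Ω) := by
  intro u v h
  have : toL2 w ν Ω u = toL2 w ν Ω v := congrArg (fun p => p.fst) h
  exact Subtype.ext this

/-- The norm of `S_w^ν(Ω)` is the norm of `(u, 𝔊u)`; see `norm_def`. -/
instance : NormedAddCommGroup (Sobolev w ν Ω) :=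
  NormedAddCommGroup.induced (Sobolev w ν Ω) _ (graphMap w ν Ω) (graphMap_injective w ν Ω)

instance : InnerProductSpace ℝ (Sobolev w ν Ω) :=
  InnerProductSpace.induced (graphMap w ν Ω)

lemma norm_def (u : Sobolev w ν Ω) :
    ‖u‖ = √(‖toL2 w ν Ω u‖ ^ 2 + ‖grad w ν Ω u‖ ^ 2) :=
  WithLp.prod_norm_eq_of_L2 (graphMap w ν Ω u)

end Sobolev

end Space

/-- `C_c^∞(Ω)`: the smooth functions on `ℝ^d` with compact support contained in `Ω`. -/
def testFunctions {d : ℕ} (Ω : Set (Rd d)) : Set (Rd d → ℝ) :=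
  {φ | ContDiff ℝ ∞ φ ∧ HasCompactSupport φ ∧ tsupport φ ⊆ Ω}

/-! ### Domains -/

/-- The open region `{x = (x', x_d) : x_d > ζ(x')}` above the graph of `ζ` in `ℝ^d`, `d = n + 1`. -/
def aboveGraph {n : ℕ} (ζ : Rd n → ℝ) : Set (Rd (n + 1)) :=
  {x | ζ (WithLp.toLp 2 fun i : Fin n => x i.castSucc) < x (Fin.last n)}

/-- `Ω` is an epigraph: up to a rigid motion it is the region above the graph of a continuous
function. -/
def IsEpigraph {n : ℕ} (Ω : Set (Rd (n + 1))) : Prop :=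
  ∃ (T : Rd (n + 1) ≃ᵃⁱ[ℝ] Rd (n + 1)) (ζ : Rd n → ℝ), Continuous ζ ∧ Ω = T ⁻¹' aboveGraph ζ

/-- `Ω` has a continuous boundary: in a ball around each boundary point, `Ω` coincides with an
epigraph. -/
def HasContinuousBoundary {n : ℕ} (Ω : Set (Rd (n + 1))) : Prop :=
  ∀ x₀ ∈ frontier Ω, ∃ r > 0, ∃ E : Set (Rd (n + 1)), IsEpigraph E ∧
    Ω ∩ Metric.ball x₀ r = E ∩ Metric.ball x₀ r

/-- `Ω` is a domain: an open connected set. -/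
def IsDomainSet {d : ℕ} (Ω : Set (Rd d)) : Prop :=
  IsOpen Ω ∧ IsConnected Ω

end HalfBall

end

/-!
The nonlocal gradient `𝔊` is an integral operator with a kernel that depends on `y - x` only and has
`min (1, |z|) w(z)` integrable. So its graph `{(u, 𝔊u)}` is a closed subspace of
`L²(ℝ^d) × L²(ℝ^d; ℝ^d)` that is invariant under translations (`translate_mem_gradGraph`), and
multiplication by a test function `η` acts on it by a Leibniz rule `𝔊(ηu) = η 𝔊u + c`. The
commutator `c` has the kernel `χ_ν(z) (η(x + z) - η(x)) w(z) z / |z|`, which is dominated by an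
integrable function of `z`, and Young's inequality bounds `‖c‖₂` by `‖u‖₂` times the integral of `m(z) w(z)`, for any bound `m`
of `|η(x + z) - η(x)|` (`exists_mul_mem_gradGraph`). The same rule with `u = 1`, `𝔊u = 0` shows that
test functions have a gradient in `L²` (`hasDistGrad_testFunction`).

For the density, a pair `(u, 𝔊u)` is modified in four ways, each time changing little in
`L² × L²`:
* Cutoff at infinity: for `η(x / R)` the commutator tends to zero as `R → ∞`
  (`exists_tendsto_compactSupport`).
* Localization: the Leibniz rule splits `u` into finitely many pieces supported in small balls
  (`mem_closure_testPairs_of_finite_cover`).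
* Translation: in a small ball `Ω` is an epigraph, and moving the piece a little upwards puts its
  support into a compact subset of `Ω` (`HasInwardDirections`,
  `mem_closure_testPairs_of_translate`). Translations are continuous in `L²`.
* Mollification: convolution is a Bochner average of translates, so it stays in the closed graph,
  and it produces test functions once the support is compact in `Ω`
  (`mem_closure_testPairs_of_compact`).
-/

noncomputable section

namespace HalfBall

/-! ### The graph of the distributional gradient as a closed subspace -/

section L2Graph

variable {d : ℕ}

/-- The Hilbert space `L²(ℝ^d; E)`. -/
abbrev L2 (d : ℕ) (E : Type*) [NormedAddCommGroup E] : Type _ :=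
  Lp E 2 (volume : Measure (Rd d))

lemma memLp_testField {φ : Rd d → Rd d} (h1 : ContDiff ℝ ∞ φ) (h2 : HasCompactSupport φ) :
    MemLp φ 2 (volume : Measure (Rd d)) :=
  h1.continuous.memLp_of_hasCompactSupport h2

/-- The continuous functional `(u, g) ↦ ∫ u D^{-ν} φ + ∫ g ⬝ φ` on pairs. A pair `(u, g)` satisfies
`g = 𝔊u` exactly when all these functionals vanish on it. -/
def gradDefect (w : Kernel d) (ν : Rd d) {φ : Rd d → Rd d} (h1 : ContDiff ℝ ∞ φ)
    (h2 : HasCompactSupport φ) : (L2 d ℝ × L2 d (Rd d)) →L[ℝ] ℝ :=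
  (innerSL ℝ ((memLp_divergence w (-ν) φ h1 h2).toLp _)).comp
      (ContinuousLinearMap.fst ℝ (L2 d ℝ) (L2 d (Rd d))) +
    (innerSL ℝ ((memLp_testField h1 h2).toLp φ)).comp
      (ContinuousLinearMap.snd ℝ (L2 d ℝ) (L2 d (Rd d)))

lemma gradDefect_apply (w : Kernel d) (ν : Rd d) {φ : Rd d → Rd d} (h1 : ContDiff ℝ ∞ φ)
    (h2 : HasCompactSupport φ) (p : L2 d ℝ × L2 d (Rd d)) :
    gradDefect w ν h1 h2 p
      = (∫ x, p.1 x * divergence w (-ν) φ x) + ∫ x, inner ℝ (p.2 x) (φ x) := by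
  simp only [gradDefect, add_apply, ContinuousLinearMap.comp_apply,
    ContinuousLinearMap.coe_fst', ContinuousLinearMap.coe_snd', innerSL_apply_apply, L2.inner_def]
  congr 1
  · refine integral_congr_ae ?_
    filter_upwards [(memLp_divergence w (-ν) φ h1 h2).coeFn_toLp] with x hx
    rw [hx]
    simp
  · refine integral_congr_ae ?_
    filter_upwards [(memLp_testField h1 h2).coeFn_toLp] with x hx
    rw [hx, real_inner_comm]

/-- The graph `{(u, 𝔊u)}` in `L²(ℝ^d) × L²(ℝ^d; ℝ^d)`. -/
def gradGraph (w : Kernel d) (ν : Rd d) : Submodule ℝ (L2 d ℝ × L2 d (Rd d)) where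
  carrier := {p | HasDistGrad w ν p.1 p.2}
  zero_mem' := by
    obtain ⟨g, hg⟩ := ((sobolevSubmodule w ν Set.univ).zero_mem).2
    have := hg.smul 0
    rwa [zero_smul, zero_smul] at this
  add_mem' h h' := HasDistGrad.add h h'
  smul_mem' c _ h := HasDistGrad.smul c h

lemma mem_gradGraph {w : Kernel d} {ν : Rd d} {p : L2 d ℝ × L2 d (Rd d)} :
    p ∈ gradGraph w ν ↔ HasDistGrad w ν p.1 p.2 := Iff.rfl

lemma mem_gradGraph_iff {w : Kernel d} {ν : Rd d} {p : L2 d ℝ × L2 d (Rd d)} :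
    p ∈ gradGraph w ν ↔ ∀ (φ : Rd d → Rd d) (h1 : ContDiff ℝ ∞ φ) (h2 : HasCompactSupport φ),
      gradDefect w ν h1 h2 p = 0 := by
  rw [mem_gradGraph, HasDistGrad]
  refine forall_congr' fun φ => forall_congr' fun h1 => forall_congr' fun h2 => ?_
  rw [gradDefect_apply, distGradPairing, neg_eq_iff_add_eq_zero]

/-- Weighted Bochner averages of pairs in the graph stay in the graph. -/
lemma integral_smul_mem_gradGraph {w : Kernel d} {ν : Rd d} {ρ : Rd d → ℝ}
    {F : Rd d → L2 d ℝ × L2 d (Rd d)} (hF : ∀ z, F z ∈ gradGraph w ν)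
    (hint : Integrable fun z => ρ z • F z) : ∫ z, ρ z • F z ∈ gradGraph w ν := by
  rw [mem_gradGraph_iff]
  intro φ h1 h2
  rw [← ContinuousLinearMap.integral_comp_comm _ hint]
  refine integral_eq_zero_of_ae (Eventually.of_forall fun z => ?_)
  simp [mem_gradGraph_iff.1 (hF z) φ h1 h2]

/-! ### Translations -/

section Translate

variable {E : Type*} [NormedAddCommGroup E] [NormedSpace ℝ E]

/-- The translation `f ↦ f(⬝ - z)` on `L²`, which moves supports by `+z`. -/
def translate (z : Rd d) : L2 d E →ₗᵢ[ℝ] L2 d E :=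
  Lp.compMeasurePreservingₗᵢ ℝ (fun x => x - z) (measurePreserving_sub_right volume z)

lemma coeFn_translate (z : Rd d) (f : L2 d E) : translate z f =ᵐ[volume] fun x => f (x - z) :=
  Lp.coeFn_compMeasurePreserving f (measurePreserving_sub_right volume z)

lemma continuous_translate (f : L2 d E) : Continuous fun z : Rd d => translate z f := by
  let T : Rd d → C(Rd d, Rd d) := fun z => ⟨fun x => x - z, by fun_prop⟩
  have hT : Continuous T := ContinuousMap.continuous_of_continuous_uncurry _
    (by change Continuous fun p : Rd d × Rd d => p.2 - p.1; fun_prop)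
  exact (continuous_const (y := f)).compMeasurePreservingLp hT
    (fun z => measurePreserving_sub_right volume z) (by norm_num)

lemma translate_zero (f : L2 d E) : translate (0 : Rd d) f = f := by
  refine Lp.ext ?_
  filter_upwards [coeFn_translate (0 : Rd d) f] with x hx
  rw [hx, sub_zero]

end Translate

lemma divergence_comp_add (w : Kernel d) (ν z : Rd d) {φ : Rd d → Rd d} (h1 : ContDiff ℝ ∞ φ)
    (h2 : HasCompactSupport φ) (x : Rd d) :
    divergence w ν (fun y => φ (y + z)) x = divergence w ν φ (x + z) := by
  have h1' : ContDiff ℝ ∞ fun y => φ (y + z) := h1.comp (contDiff_id.add contDiff_const)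
  have h2' : HasCompactSupport fun y => φ (y + z) :=
    h2.comp_homeomorph (Homeomorph.addRight z)
  rw [divergence_eq _ _ _ h1' h2', divergence_eq _ _ _ h1 h2]
  refine integral_congr_ae (Eventually.of_forall fun y => ?_)
  simp only [quot, add_right_comm]

/-- The nonlocal gradient commutes with translations. -/
lemma translate_mem_gradGraph {w : Kernel d} {ν : Rd d} {p : L2 d ℝ × L2 d (Rd d)}
    (hp : p ∈ gradGraph w ν) (z : Rd d) :
    (translate z p.1, translate z p.2) ∈ gradGraph w ν := by
  intro φ h1 h2
  have h1' : ContDiff ℝ ∞ fun y => φ (y + z) := h1.comp (contDiff_id.add contDiff_const)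
  have h2' : HasCompactSupport fun y => φ (y + z) :=
    h2.comp_homeomorph (Homeomorph.addRight z)
  have key := hp _ h1' h2'
  simp only [distGradPairing, divergence_comp_add w (-ν) z h1 h2] at key ⊢
  have e1 : ∫ x, (translate z p.1) x * divergence w (-ν) φ x
      = ∫ x, p.1 x * divergence w (-ν) φ (x + z) := by
    rw [← integral_sub_right_eq_self (fun x => p.1 x * divergence w (-ν) φ (x + z)) z]
    refine integral_congr_ae ?_
    filter_upwards [coeFn_translate z p.1] with x hx
    rw [hx, sub_add_cancel]
  have e2 : ∫ x, inner ℝ ((translate z p.2) x) (φ x) = ∫ x, inner ℝ (p.2 x) (φ (x + z)) := by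
    rw [← integral_sub_right_eq_self (fun x => inner ℝ (p.2 x) (φ (x + z))) z]
    refine integral_congr_ae ?_
    filter_upwards [coeFn_translate z p.2] with x hx
    rw [hx, sub_add_cancel]
  rw [e1, e2, key]

/-! ### Mollification -/

/-- The pairs `(φ, 𝔊φ)` with `φ ∈ C_c^∞(Ω)`, as a subspace of the graph. -/
def testPairs (w : Kernel d) (ν : Rd d) (Ω : Set (Rd d)) :
    Submodule ℝ (L2 d ℝ × L2 d (Rd d)) where
  carrier := {p | p ∈ gradGraph w ν ∧ ∃ φ ∈ testFunctions Ω, p.1 =ᵐ[volume] φ}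
  zero_mem' := by
    refine ⟨zero_mem _, 0, ⟨contDiff_const, HasCompactSupport.zero, ?_⟩, Lp.coeFn_zero _ _ _⟩
    simp [tsupport]
  add_mem' := by
    rintro p q ⟨hp, φ, ⟨a1, a2, a3⟩, hφ⟩ ⟨hq, ψ, ⟨b1, b2, b3⟩, hψ⟩
    refine ⟨add_mem hp hq, φ + ψ, ⟨a1.add b1, a2.add b2, ?_⟩, ?_⟩
    · exact (tsupport_add φ ψ).trans (Set.union_subset a3 b3)
    · exact (Lp.coeFn_add p.1 q.1).trans (hφ.add hψ)
  smul_mem' := by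
    rintro c p ⟨hp, φ, ⟨a1, a2, a3⟩, hφ⟩
    refine ⟨Submodule.smul_mem _ c hp, c • φ, ⟨a1.const_smul c, a2.smul_left, ?_⟩, ?_⟩
    · exact (closure_mono (Function.support_const_smul_subset c φ)).trans a3
    · exact (Lp.coeFn_smul c p.1).trans (hφ.const_smul c)

/-- The Bochner average of the translates of `u` is represented by the convolution. -/
lemma integral_translate_ae_eq_convolution {ρ : Rd d → ℝ} (hρ : Continuous ρ)
    (hρc : HasCompactSupport ρ) (u : L2 d ℝ) :
    (∫ z, ρ z • translate z u : L2 d ℝ) =ᵐ[volume]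
      convolution ρ u (ContinuousLinearMap.lsmul ℝ ℝ) volume := by
  have hu : LocallyIntegrable (u : Rd d → ℝ) := (Lp.memLp u).locallyIntegrable (by norm_num)
  have hint : Integrable fun z => ρ z • translate z u :=
    (hρ.smul (continuous_translate u)).integrable_of_hasCompactSupport hρc.smul_right
  refine ae_eq_of_integral_contDiff_smul_eq
    ((Lp.memLp _).locallyIntegrable (by norm_num))
    (hρc.continuous_convolution_left _ hρ hu).locallyIntegrable fun ψ h1 h2 => ?_
  have hψ : MemLp ψ 2 (volume : Measure (Rd d)) := h1.continuous.memLp_of_hasCompactSupport h2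
  have hin : ∀ f : L2 d ℝ, ∫ x, ψ x • f x = inner ℝ (hψ.toLp ψ) f := fun f => by
    rw [L2.inner_def]
    refine integral_congr_ae ?_
    filter_upwards [hψ.coeFn_toLp] with x hx
    rw [hx]; simp [mul_comm]
  -- the double integral below converges absolutely: `ρ` is integrable, `ψ` and `u` are in `L²`
  have hsq : Integrable (fun p : Rd d × Rd d => ρ p.2 * (ψ p.1 * u (p.1 - p.2)))
      (volume.prod volume) := by
    have hmp : MeasurePreserving (fun p : Rd d × Rd d => (p.1 - p.2, p.2))
        (volume.prod volume) (volume.prod volume) := measurePreserving_sub_prod volume volume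
    have hρi : Integrable ρ := hρ.integrable_of_hasCompactSupport hρc
    have i1 : Integrable (fun p : Rd d × Rd d => ψ p.1 ^ 2 * ‖ρ p.2‖) (volume.prod volume) :=
      (hψ.integrable_sq).mul_prod hρi.norm
    have i2 : Integrable (fun p : Rd d × Rd d => u (p.1 - p.2) ^ 2 * ‖ρ p.2‖)
        (volume.prod volume) :=
      hmp.integrable_comp_of_integrable ((Lp.memLp u).integrable_sq.mul_prod hρi.norm)
    refine (i1.add i2).mono' ?_ (Eventually.of_forall fun p => ?_)
    · have hum : AEStronglyMeasurable (fun p : Rd d × Rd d => u (p.1 - p.2))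
          (volume.prod volume) :=
        ((Lp.memLp u).aestronglyMeasurable.comp_fst (ν := volume)).comp_measurePreserving hmp
      exact (hρ.comp continuous_snd).aestronglyMeasurable.mul
        ((h1.continuous.comp continuous_fst).aestronglyMeasurable.mul hum)
    · simp only [Pi.add_apply]
      rw [norm_mul, ← add_mul, mul_comm]
      refine mul_le_mul_of_nonneg_right ?_ (norm_nonneg _)
      rw [norm_mul, ← sq_abs (ψ p.1), ← sq_abs (u (p.1 - p.2)), Real.norm_eq_abs, Real.norm_eq_abs]
      nlinarith [sq_nonneg (|ψ p.1| - |u (p.1 - p.2)|), sq_nonneg (|ψ p.1|),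
        sq_nonneg (|u (p.1 - p.2)|)]
  rw [hin, ← innerSL_apply_apply ℝ, ← ContinuousLinearMap.integral_comp_comm _ hint]
  have e1 : ∀ z, innerSL ℝ (hψ.toLp ψ) (ρ z • translate z u)
      = ∫ x, ρ z * (ψ x * u (x - z)) := fun z => by
    rw [map_smul, innerSL_apply_apply, ← hin, smul_eq_mul, integral_const_mul]
    congr 1
    refine integral_congr_ae ?_
    filter_upwards [coeFn_translate z u] with x hx
    rw [hx, smul_eq_mul]
  simp only [e1]
  rw [← integral_integral_swap (f := fun x z => ρ z * (ψ x * u (x - z))) hsq]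
  refine integral_congr_ae (Eventually.of_forall fun x => ?_)
  simp only [convolution_def, ContinuousLinearMap.lsmul_apply, smul_eq_mul]
  rw [← integral_const_mul]
  refine integral_congr_ae (Eventually.of_forall fun z => ?_)
  ring

/-- A pair in the graph whose first component lives on a compact subset of `Ω` is the limit of its
mollifications, which are test pairs. -/
lemma mem_closure_testPairs_of_compact {w : Kernel d} {ν : Rd d} {Ω K : Set (Rd d)}
    (hΩ : IsOpen Ω) (hK : IsCompact K) (hKΩ : K ⊆ Ω) {p : L2 d ℝ × L2 d (Rd d)}
    (hp : p ∈ gradGraph w ν) (hpK : ∀ᵐ x, x ∉ K → p.1 x = 0) :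
    p ∈ (testPairs w ν Ω).topologicalClosure := by
  obtain ⟨δ, hδ, hδΩ⟩ := hK.exists_cthickening_subset_open hΩ hKΩ
  let F : Rd d → L2 d ℝ × L2 d (Rd d) := fun z => (translate z p.1, translate z p.2)
  have hF : Continuous F := (continuous_translate p.1).prodMk (continuous_translate p.2)
  let ρ : ℕ → ContDiffBump (0 : Rd d) := fun n =>
    ⟨δ / (n + 1) / 2, δ / (n + 1), by positivity, half_lt_self (by positivity)⟩
  have hρ0 : Tendsto (fun n => (ρ n).rOut) atTop (𝓝 0) := by
    have := (tendsto_one_div_add_atTop_nhds_zero_nat (𝕜 := ℝ)).const_mul δ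
    simpa [ρ, div_eq_mul_inv] using this
  have hlim := ContDiffBump.convolution_tendsto_right_of_continuous (μ := volume) hρ0
    (hF.comp continuous_neg) 0
  have e : ∀ n, convolution ((ρ n).normed volume) (F ∘ Neg.neg) (ContinuousLinearMap.lsmul ℝ ℝ)
      volume 0 = ∫ z, (ρ n).normed volume z • F z := fun n => by
    simp [convolution_def]
  have e0 : (F ∘ Neg.neg) 0 = p := by
    simp [F, translate_zero]
  simp only [e, e0] at hlim
  refine mem_closure_of_tendsto hlim (Eventually.of_forall fun n => ?_)
  have hc : HasCompactSupport ((ρ n).normed (volume : Measure (Rd d))) :=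
    (ρ n).hasCompactSupport_normed
  have hint : Integrable fun z => (ρ n).normed volume z • F z :=
    ((ρ n).continuous_normed.smul hF).integrable_of_hasCompactSupport hc.smul_right
  refine ⟨integral_smul_mem_gradGraph (fun z => translate_mem_gradGraph hp z) hint,
    convolution ((ρ n).normed volume) p.1 (ContinuousLinearMap.lsmul ℝ ℝ) volume, ?_, ?_⟩
  · have hsupp : Function.support (convolution ((ρ n).normed volume) p.1
        (ContinuousLinearMap.lsmul ℝ ℝ) volume) ⊆ Metric.cthickening δ K := by
      have : convolution ((ρ n).normed volume) p.1 (ContinuousLinearMap.lsmul ℝ ℝ) volume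
          = convolution ((ρ n).normed volume) (K.indicator p.1)
            (ContinuousLinearMap.lsmul ℝ ℝ) volume := by
        refine convolution_congr _ EventuallyEq.rfl ?_
        filter_upwards [hpK] with x hx
        by_cases h : x ∈ K
        · rw [Set.indicator_of_mem h]
        · rw [Set.indicator_of_notMem h, hx h]
      rw [this]
      refine (support_convolution_subset _).trans ?_
      rw [(ρ n).support_normed_eq]
      rintro _ ⟨a, ha, b, hb, rfl⟩
      have hbK : b ∈ K := by
        by_contra h
        exact hb (Set.indicator_of_notMem h _)
      refine Metric.mem_cthickening_of_dist_le _ b _ _ hbK ?_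
      have h1 : ‖a‖ < (ρ n).rOut := by simpa using ha
      have h2 : (ρ n).rOut ≤ δ := div_le_self hδ.le (by linarith [n.cast_nonneg (α := ℝ)])
      simpa [dist_eq_norm] using (h1.trans_le h2).le
    have hcl : tsupport (convolution ((ρ n).normed volume) p.1
        (ContinuousLinearMap.lsmul ℝ ℝ) volume) ⊆ Metric.cthickening δ K :=
      closure_minimal hsupp Metric.isClosed_cthickening
    refine ⟨?_, ?_, hcl.trans hδΩ⟩
    · have hs : ContDiff ℝ ((⊤ : ℕ∞) : WithTop ℕ∞) ((ρ n).normed (volume : Measure (Rd d))) :=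
        (ρ n).contDiff_normed
      exact hc.contDiff_convolution_left _ hs
        ((Lp.memLp p.1).locallyIntegrable (by norm_num))
    · exact hK.cthickening.of_isClosed_subset (isClosed_tsupport _) hcl
  · rw [fst_integral hint]
    exact integral_translate_ae_eq_convolution (ρ n).continuous_normed hc p.1

/-! ### Products with test functions -/

/-- The `L¹ * L² ⊆ L²` case of Young's inequality, for integral operators whose kernel is dominated
by a convolution kernel. -/
lemma eLpNorm_integral_le_of_enorm_le {E F : Type*} [NormedAddCommGroup E] [NormedSpace ℝ E]
    [NormedAddCommGroup F] {f : Rd d × Rd d → E} {u : Rd d → F} {M : Rd d → ENNReal}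
    (hu : AEStronglyMeasurable u) (hM : AEMeasurable M)
    (h : ∀ x z, ‖f (x, z)‖ₑ ≤ ‖u (x + z)‖ₑ * M z) :
    eLpNorm (fun x => ∫ z, f (x, z)) 2 volume ≤ (∫⁻ z, M z) * eLpNorm u 2 volume := by
  have hmp : MeasurePreserving (fun p : Rd d × Rd d => (p.1 + p.2, p.2))
      (volume.prod volume) (volume.prod volume) := measurePreserving_add_prod volume volume
  have h1 : ∀ x : Rd d, ‖∫ z, f (x, z)‖ₑ ^ (2 : ℝ)
      ≤ (∫⁻ z, M z) * ∫⁻ z, M z * ‖u (x + z)‖ₑ ^ (2 : ℝ) := by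
    intro x
    have hux : AEMeasurable (fun z => ‖u (x + z)‖ₑ) volume :=
      (hu.comp_measurePreserving (measurePreserving_add_left volume x)).enorm
    have hCS : ∫⁻ z, ‖u (x + z)‖ₑ * M z
        ≤ (∫⁻ z, M z) ^ (1 / 2 : ℝ) * (∫⁻ z, M z * ‖u (x + z)‖ₑ ^ (2 : ℝ)) ^ (1 / 2 : ℝ) := by
      refine le_trans (lintegral_mono fun z => ?_)
        (ENNReal.lintegral_mul_norm_pow_le (p := 1 / 2) (q := 1 / 2) hM
          (hM.mul (hux.pow_const 2)) (by norm_num) (by norm_num) (by norm_num))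
      rw [Pi.mul_apply, ENNReal.mul_rpow_of_nonneg _ _ (by norm_num), ← mul_assoc,
        ← ENNReal.rpow_add_of_nonneg _ _ (by norm_num) (by norm_num), ← ENNReal.rpow_mul]
      norm_num
      rw [mul_comm]
    calc ‖∫ z, f (x, z)‖ₑ ^ (2 : ℝ)
        ≤ (∫⁻ z, ‖u (x + z)‖ₑ * M z) ^ (2 : ℝ) := by
          gcongr
          exact (enorm_integral_le_lintegral_enorm _).trans (lintegral_mono fun z => h x z)
      _ ≤ ((∫⁻ z, M z) ^ (1 / 2 : ℝ)
          * (∫⁻ z, M z * ‖u (x + z)‖ₑ ^ (2 : ℝ)) ^ (1 / 2 : ℝ)) ^ (2 : ℝ) := by gcongr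
      _ = _ := by
          rw [ENNReal.mul_rpow_of_nonneg _ _ (by norm_num), ← ENNReal.rpow_mul,
            ← ENNReal.rpow_mul]
          norm_num
  have hmeas : AEMeasurable (fun p : Rd d × Rd d => M p.2 * ‖u (p.1 + p.2)‖ₑ ^ (2 : ℝ))
      (volume.prod volume) := by
    have hu2 : AEStronglyMeasurable (fun p : Rd d × Rd d => u (p.1 + p.2))
        (volume.prod volume) := (hu.comp_fst (ν := volume)).comp_measurePreserving hmp
    exact (hM.comp_quasiMeasurePreserving Measure.quasiMeasurePreserving_snd).mul
      (hu2.enorm.pow_const 2)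
  have h2 : ∫⁻ x, ∫⁻ z, M z * ‖u (x + z)‖ₑ ^ (2 : ℝ)
      = (∫⁻ z, M z) * ∫⁻ x, ‖u x‖ₑ ^ (2 : ℝ) := by
    rw [lintegral_lintegral_swap hmeas, ← lintegral_mul_const'' _ hM]
    refine lintegral_congr fun z => ?_
    have hux : AEMeasurable (fun x => ‖u (x + z)‖ₑ ^ (2 : ℝ)) volume :=
      (hu.comp_measurePreserving (measurePreserving_add_right volume z)).enorm.pow_const 2
    rw [lintegral_const_mul'' _ hux,
      lintegral_add_right_eq_self (fun x => ‖u x‖ₑ ^ (2 : ℝ)) z]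
  have hmeas' : AEMeasurable (fun x : Rd d => ∫⁻ z, M z * ‖u (x + z)‖ₑ ^ (2 : ℝ)) :=
    hmeas.lintegral_prod_right'
  rw [eLpNorm_eq_lintegral_rpow_enorm_toReal (by norm_num) (by norm_num),
    eLpNorm_eq_lintegral_rpow_enorm_toReal (by norm_num) (by norm_num)]
  simp only [ENNReal.toReal_ofNat]
  calc (∫⁻ x, ‖∫ z, f (x, z)‖ₑ ^ (2 : ℝ)) ^ (1 / 2 : ℝ)
      ≤ (∫⁻ x, (∫⁻ z, M z) * ∫⁻ z, M z * ‖u (x + z)‖ₑ ^ (2 : ℝ)) ^ (1 / 2 : ℝ) := by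
        gcongr
        exact h1 _
    _ = ((∫⁻ z, M z) ^ (2 : ℝ) * ∫⁻ x, ‖u x‖ₑ ^ (2 : ℝ)) ^ (1 / 2 : ℝ) := by
        rw [lintegral_const_mul'' _ hmeas', h2, ← mul_assoc, ENNReal.rpow_two, sq]
    _ = _ := by
        rw [ENNReal.mul_rpow_of_nonneg _ _ (by norm_num), ← ENNReal.rpow_mul]
        norm_num

section Leibniz

variable (w : Kernel d) (ν : Rd d)

/-- The kernel `χ_ν(z) (η(x + z) - η(x)) z / |z|` of the commutator of the nonlocal gradient with
multiplication by `η`, divided by `min (1, |z|)` to make it bounded. -/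
def commKernel (η : Rd d → ℝ) (x z : Rd d) : Rd d :=
  (halfSpaceChar ν z * (η (x + z) - η x) * (min 1 ‖z‖)⁻¹) • (‖z‖⁻¹ • z)

/-- The integrand `χ_ν(z) u(x + z) (η(x + z) - η(x)) w(z) z / |z|` of the commutator, for use with
`commKernel`. -/
def commIntegrand (η u : Rd d → ℝ) (p : Rd d × Rd d) : Rd d :=
  (u (p.1 + p.2) * weight w p.2) • commKernel ν η p.1 p.2

/-- The commutator `𝔊(η u) - η 𝔊u`. -/
def commutator (η u : Rd d → ℝ) (x : Rd d) : Rd d :=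
  ∫ z, commIntegrand w ν η u (x, z)

variable {ν}

lemma abs_halfSpaceChar_le (z : Rd d) : |halfSpaceChar ν z| ≤ 1 := by
  unfold halfSpaceChar
  by_cases h : z ∈ {z : Rd d | 0 ≤ inner ℝ z ν}
  · rw [Set.indicator_of_mem h]; simp
  · rw [Set.indicator_of_notMem h]; simp

lemma halfSpaceChar_neg_neg (z : Rd d) : halfSpaceChar (-ν) (-z) = halfSpaceChar ν z := by
  simp [halfSpaceChar, Set.indicator]

lemma weight_neg (z : Rd d) : weight w (-z) = weight w z := by
  simp [weight, w.radial (-z) z (norm_neg z)]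

/-- Reflection exchanges the half-spaces of `-ν` and `ν`. -/
lemma commKernel_neg (η : Rd d → ℝ) (x z : Rd d) :
    commKernel (-ν) η (x + z) (-z) = commKernel ν η x z := by
  simp only [commKernel, halfSpaceChar_neg_neg, add_neg_cancel_right, norm_neg, smul_neg]
  rw [← neg_smul]
  congr 1
  ring

lemma measurable_commKernel {η : Rd d → ℝ} (hη : Continuous η) :
    Measurable fun p : Rd d × Rd d => commKernel ν η p.1 p.2 := by
  have h1 : Measurable (halfSpaceChar ν) :=
    measurable_one.indicator (isClosed_le continuous_const (by fun_prop)).measurableSet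
  have h2 : Measurable fun p : Rd d × Rd d => η (p.1 + p.2) - η p.1 :=
    Continuous.measurable (by fun_prop)
  have h3 : Measurable fun p : Rd d × Rd d => ‖p.2‖⁻¹ • p.2 := by fun_prop
  have h4 : Measurable fun p : Rd d × Rd d => (min 1 ‖p.2‖)⁻¹ := by fun_prop
  exact (((h1.comp measurable_snd).mul h2).mul h4).smul h3

lemma weight_mul_norm_commKernel_le {η : Rd d → ℝ} {m : ℝ} {x z : Rd d}
    (h : |η (x + z) - η x| ≤ m) : weight w z * ‖commKernel ν η x z‖ ≤ m * w.toFun z := by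
  have hm : 0 ≤ m := (abs_nonneg _).trans h
  by_cases hz : z = 0
  · simpa [hz, weight] using mul_nonneg hm (w.nonneg 0)
  have hzn : 0 < ‖z‖ := norm_pos_iff.2 hz
  have hmin : 0 < min 1 ‖z‖ := lt_min one_pos hzn
  have hu : ‖‖z‖⁻¹ • z‖ = 1 := by rw [norm_smul, norm_inv, norm_norm, inv_mul_cancel₀ hzn.ne']
  rw [commKernel, norm_smul, hu, mul_one, weight, Real.norm_eq_abs, abs_mul, abs_mul,
    abs_of_pos (inv_pos.2 hmin)]
  have h1 : |halfSpaceChar ν z| * |η (x + z) - η x| ≤ 1 * m :=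
    mul_le_mul (abs_halfSpaceChar_le z) h (abs_nonneg _) zero_le_one
  calc min 1 ‖z‖ * w.toFun z * (|halfSpaceChar ν z| * |η (x + z) - η x| * (min 1 ‖z‖)⁻¹)
      = |halfSpaceChar ν z| * |η (x + z) - η x| * w.toFun z := by field_simp
    _ ≤ _ := by
      rw [one_mul] at h1
      exact mul_le_mul_of_nonneg_right h1 (w.nonneg z)

/-- The pointwise Leibniz rule under the integral sign. -/
lemma quot_smul (η : Rd d → ℝ) (φ : Rd d → Rd d) (x z : Rd d) :
    quot ν (fun y => η y • φ y) x z
      = η x * quot ν φ x z + inner ℝ (commKernel ν η x z) (φ (x + z)) := by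
  simp only [quot, commKernel, inner_smul_left, inner_sub_right, inner_smul_right,
    RCLike.conj_to_real]
  ring

lemma aestronglyMeasurable_commIntegrand {η u : Rd d → ℝ} (hη : Continuous η)
    (hu : AEStronglyMeasurable u) :
    AEStronglyMeasurable (commIntegrand w ν η u) (volume.prod volume) := by
  have hmp : MeasurePreserving (fun p : Rd d × Rd d => (p.1 + p.2, p.2))
      (volume.prod volume) (volume.prod volume) := measurePreserving_add_prod volume volume
  have hu2 : AEStronglyMeasurable (fun p : Rd d × Rd d => u (p.1 + p.2))
      (volume.prod volume) := (hu.comp_fst (ν := volume)).comp_measurePreserving hmp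
  exact (hu2.mul (w.integrable.aestronglyMeasurable.comp_snd)).smul
    (measurable_commKernel hη).aestronglyMeasurable

/-- The smooth compactly supported functions have difference quotients of size `min (1, |z|)`. -/
lemma exists_abs_sub_le_min {η : Rd d → ℝ} (h1 : ContDiff ℝ ∞ η) (h2 : HasCompactSupport η) :
    ∃ C : ℝ, 0 ≤ C ∧ ∀ x z, |η (x + z) - η x| ≤ C * min 1 ‖z‖ := by
  obtain ⟨L, hL⟩ := ContDiff.lipschitzWith_of_hasCompactSupport h2 h1 (by simp)
  obtain ⟨M, hM⟩ := h2.exists_bound_of_continuous h1.continuous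
  have hM0 : 0 ≤ M := (norm_nonneg _).trans (hM 0)
  have hL0 : (0 : ℝ) ≤ L := L.2
  refine ⟨L + 2 * M, by positivity, fun x z => ?_⟩
  have h1 : |η (x + z) - η x| ≤ L * ‖z‖ := by
    simpa [dist_eq_norm] using hL.dist_le_mul (x + z) x
  have h2 : |η (x + z) - η x| ≤ 2 * M := by
    have := norm_sub_le (η (x + z)) (η x)
    rw [Real.norm_eq_abs] at this
    linarith [hM (x + z), hM x]
  rcases min_cases 1 ‖z‖ with ⟨h, h'⟩ | ⟨h, h'⟩ <;> rw [h]
  · linarith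
  · nlinarith [norm_nonneg z]

/-- The involution `(x, z) ↦ (x + z, -z)`, which exchanges the two points `x` and `x + z` of a
difference quotient. -/
def shearNeg (d : ℕ) : Rd d × Rd d ≃ᵐ Rd d × Rd d where
  toFun p := (p.1 + p.2, -p.2)
  invFun p := (p.1 + p.2, -p.2)
  left_inv p := by simp
  right_inv p := by simp
  measurable_toFun :=
    (show Continuous fun p : Rd d × Rd d => (p.1 + p.2, -p.2) by fun_prop).measurable
  measurable_invFun :=
    (show Continuous fun p : Rd d × Rd d => (p.1 + p.2, -p.2) by fun_prop).measurable

lemma shearNeg_apply (p : Rd d × Rd d) : shearNeg d p = (p.1 + p.2, -p.2) := rfl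

lemma measurePreserving_shearNeg (d : ℕ) :
    MeasurePreserving (shearNeg d) (volume.prod volume) (volume.prod volume) :=
  ((MeasurePreserving.id volume).prod (Measure.measurePreserving_neg volume)).comp
    (measurePreserving_add_prod volume volume)

/-- The **Leibniz rule** for the distributional gradient, tested against `φ`. The hypotheses only
ask for the integrals to converge, so that `u` need not be in `L²`. -/
lemma distGradPairing_mul {η u : Rd d → ℝ} (hη1 : ContDiff ℝ ∞ η) (hη2 : HasCompactSupport η)
    (hu : AEStronglyMeasurable u) {φ : Rd d → Rd d} (h1 : ContDiff ℝ ∞ φ)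
    (h2 : HasCompactSupport φ)
    (i1 : Integrable fun x => u x * divergence w (-ν) (fun y => η y • φ y) x)
    (i2 : Integrable fun x => u x * (η x * divergence w (-ν) φ x))
    (i3 : Integrable (fun p : Rd d × Rd d => u (p.1 + p.2) * ‖φ p.1‖ * weight w p.2)
      (volume.prod volume)) :
    distGradPairing w ν (fun x => η x * u x) φ
      = distGradPairing w ν u (fun y => η y • φ y)
        + ∫ x, inner ℝ (commutator w ν η u x) (φ x) := by
  obtain ⟨C, hC0, hC⟩ := exists_abs_sub_le_min hη1 hη2
  have hηφ1 : ContDiff ℝ ∞ fun y => η y • φ y := hη1.smul h1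
  have hηφ2 : HasCompactSupport fun y => η y • φ y :=
    h2.smul_left (f := η)
  let f : Rd d × Rd d → ℝ := fun p =>
    u p.1 * (inner ℝ (commKernel (-ν) η p.1 p.2) (φ (p.1 + p.2)) * weight w p.2)
  let g : Rd d × Rd d → ℝ := fun p => inner ℝ (commIntegrand w ν η u p) (φ p.1)
  -- the measure preserving involution `(x, z) ↦ (x + z, -z)` turns `f` into `g`
  let T : Rd d × Rd d ≃ᵐ Rd d × Rd d := shearNeg d
  have hT : MeasurePreserving T (volume.prod volume) (volume.prod volume) :=
    measurePreserving_shearNeg d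
  have hfg : f ∘ T = g := by
    funext p
    simp only [f, g, T, Function.comp_apply, shearNeg_apply]
    rw [commKernel_neg, weight_neg, add_neg_cancel_right, commIntegrand, inner_smul_left]
    simp only [RCLike.conj_to_real]
    ring
  have hG : Integrable (fun p : Rd d × Rd d => ‖φ p.1‖ • commIntegrand w ν η u p)
      (volume.prod volume) := by
    refine (i3.norm.const_mul C).mono' ?_ (Eventually.of_forall fun p => ?_)
    · exact (h1.continuous.comp continuous_fst).norm.aestronglyMeasurable.smul
        (aestronglyMeasurable_commIntegrand w hη1.continuous hu)
    · have hk := weight_mul_norm_commKernel_le w (ν := ν) (hC p.1 p.2)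
      rw [commIntegrand, norm_smul, norm_smul, norm_mul, norm_mul, norm_mul, norm_norm,
        Real.norm_of_nonneg (weight_nonneg w p.2)]
      calc ‖φ p.1‖ * (‖u (p.1 + p.2)‖ * weight w p.2 * ‖commKernel ν η p.1 p.2‖)
          = ‖u (p.1 + p.2)‖ * ‖φ p.1‖ * (weight w p.2 * ‖commKernel ν η p.1 p.2‖) := by ring
        _ ≤ ‖u (p.1 + p.2)‖ * ‖φ p.1‖ * (C * min 1 ‖p.2‖ * w.toFun p.2) := by gcongr
        _ = _ := by rw [weight]; ring
  have hg : Integrable g (volume.prod volume) := by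
    refine hG.norm.mono' ?_ (Eventually.of_forall fun p => ?_)
    · exact (aestronglyMeasurable_commIntegrand w hη1.continuous hu).inner
        (h1.continuous.comp continuous_fst).aestronglyMeasurable
    · refine (norm_inner_le_norm (𝕜 := ℝ) _ _).trans (le_of_eq ?_)
      rw [norm_smul, norm_norm, mul_comm]
  have hf : Integrable f (volume.prod volume) :=
    (hT.integrable_comp_emb T.measurableEmbedding).1 (hfg ▸ hg)
  have hsum : ∀ x, u x * divergence w (-ν) (fun y => η y • φ y) x
      - u x * (η x * divergence w (-ν) φ x) = ∫ z, f (x, z) := fun x => by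
    rw [divergence_eq _ _ _ hηφ1 hηφ2, divergence_eq _ _ _ h1 h2, ← integral_const_mul (η x),
      ← mul_sub, ← integral_sub (integrable_quot_weight w _ _ hηφ1 hηφ2 x)
        ((integrable_quot_weight w _ _ h1 h2 x).const_mul _), ← integral_const_mul]
    refine integral_congr_ae (Eventually.of_forall fun z => ?_)
    simp only [f, quot_smul]
    ring
  have hswap : ∫ x, ∫ z, f (x, z) = ∫ x, ∫ z, g (x, z) := by
    rw [← integral_prod f hf, ← integral_prod g hg, ← hfg]
    exact (hT.integral_comp T.measurableEmbedding f).symm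
  have hmain := integral_sub i1 i2
  simp only [hsum] at hmain
  rw [hswap] at hmain
  have hinner : ∫ x, inner ℝ (commutator w ν η u x) (φ x) = ∫ x, ∫ z, g (x, z) := by
    refine integral_congr_ae ?_
    filter_upwards [hG.prod_right_ae] with x hx
    by_cases hφx : φ x = 0
    · simp [g, hφx]
    · have hx' : Integrable fun z => commIntegrand w ν η u (x, z) :=
        (integrable_smul_iff (norm_ne_zero_iff.2 hφx) _).1 hx
      rw [commutator, real_inner_comm, ← integral_inner hx']
      exact integral_congr_ae (Eventually.of_forall fun z => real_inner_comm _ _)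
  simp only [distGradPairing]
  rw [hinner, hmain, sub_eq_add_neg, neg_add_cancel_left]
  congr 1
  refine integral_congr_ae (Eventually.of_forall fun x => ?_)
  ring

end Leibniz

lemma HasDistGrad.congr_ae {w : Kernel d} {ν : Rd d} {u u' : Rd d → ℝ} {g g' : Rd d → Rd d}
    (h : HasDistGrad w ν u g) (hu : u' =ᵐ[volume] u) (hg : g' =ᵐ[volume] g) :
    HasDistGrad w ν u' g' := by
  intro φ h1 h2
  have e1 : ∫ x, u' x * divergence w (-ν) φ x = ∫ x, u x * divergence w (-ν) φ x :=
    integral_congr_ae (hu.mono fun x hx => by simp only [hx])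
  have e2 : ∫ x, inner ℝ (g' x) (φ x) = ∫ x, inner ℝ (g x) (φ x) :=
    integral_congr_ae (hg.mono fun x hx => by simp only [hx])
  have := h φ h1 h2
  rw [distGradPairing] at this ⊢
  rw [e1, e2, this]

lemma eLpNorm_commutator_le (w : Kernel d) {ν : Rd d} {η u : Rd d → ℝ} {m : Rd d → ℝ}
    (hm : Integrable fun z => m z * w.toFun z) (h : ∀ x z, |η (x + z) - η x| ≤ m z)
    (hu : AEStronglyMeasurable u) :
    eLpNorm (commutator w ν η u) 2 volume
      ≤ ENNReal.ofReal (∫ z, m z * w.toFun z) * eLpNorm u 2 volume := by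
  have hm0 : ∀ z, 0 ≤ m z * w.toFun z := fun z =>
    mul_nonneg ((abs_nonneg _).trans (h 0 z)) (w.nonneg z)
  rw [ofReal_integral_eq_lintegral_ofReal hm (Eventually.of_forall hm0)]
  refine eLpNorm_integral_le_of_enorm_le hu hm.aestronglyMeasurable.aemeasurable.ennreal_ofReal
    fun x z => ?_
  rw [commIntegrand, mul_smul, enorm_smul]
  gcongr
  rw [← ofReal_norm, norm_smul, Real.norm_of_nonneg (weight_nonneg w z)]
  exact ENNReal.ofReal_le_ofReal (weight_mul_norm_commKernel_le w (h x z))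

/-- Multiplication by a test function `η` preserves the graph: `𝔊(ηu) = η 𝔊u + c` with a commutator
`c` that is controlled by the modulus of continuity `m` of `η`. -/
lemma exists_mul_mem_gradGraph {w : Kernel d} {ν : Rd d} {η : Rd d → ℝ}
    (hη1 : ContDiff ℝ ∞ η) (hη2 : HasCompactSupport η) {m : Rd d → ℝ}
    (hm : Integrable fun z => m z * w.toFun z) (h : ∀ x z, |η (x + z) - η x| ≤ m z)
    {p : L2 d ℝ × L2 d (Rd d)} (hp : p ∈ gradGraph w ν) :
    ∃ u : L2 d ℝ, ∃ g c : L2 d (Rd d), (u, g + c) ∈ gradGraph w ν ∧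
      (u =ᵐ[volume] fun x => η x • p.1 x) ∧ (g =ᵐ[volume] fun x => η x • p.2 x) ∧
      ‖c‖ ≤ (∫ z, m z * w.toFun z) * ‖p.1‖ := by
  obtain ⟨B, hB⟩ := hη2.exists_bound_of_continuous hη1.continuous
  have hηm : AEStronglyMeasurable η volume := hη1.continuous.aestronglyMeasurable
  have hmu : MemLp (fun x => η x • p.1 x) 2 volume :=
    (Lp.memLp p.1).smul (memLp_top_of_bound hηm B (Eventually.of_forall hB)) (r := 2)
  have hmg : MemLp (fun x => η x • p.2 x) 2 volume :=
    (Lp.memLp p.2).smul (memLp_top_of_bound hηm B (Eventually.of_forall hB)) (r := 2)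
  have hle := eLpNorm_commutator_le w (ν := ν) hm h (Lp.memLp p.1).aestronglyMeasurable
  have hmc : MemLp (commutator w ν η p.1) 2 volume :=
    ⟨(aestronglyMeasurable_commIntegrand w hη1.continuous
        (Lp.memLp p.1).aestronglyMeasurable).integral_prod_right',
      hle.trans_lt (ENNReal.mul_lt_top ENNReal.ofReal_lt_top (Lp.memLp p.1).eLpNorm_lt_top)⟩
  refine ⟨hmu.toLp _, hmg.toLp _, hmc.toLp _, ?_, hmu.coeFn_toLp, hmg.coeFn_toLp, ?_⟩
  · have hfun : HasDistGrad w ν (fun x => η x * p.1 x)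
        (fun x => η x • p.2 x + commutator w ν η p.1 x) := by
      intro φ h1 h2
      have hηφ1 : ContDiff ℝ ∞ fun y => η y • φ y := hη1.smul h1
      have hηφ2 : HasCompactSupport fun y => η y • φ y := h2.smul_left (f := η)
      have hφ := memLp_testField h1 h2
      have i1 : Integrable fun x => p.1 x * divergence w (-ν) (fun y => η y • φ y) x :=
        (Lp.memLp p.1).integrable_mul (memLp_divergence w (-ν) _ hηφ1 hηφ2)
      have i2 : Integrable fun x => p.1 x * (η x * divergence w (-ν) φ x) := by
        refine (hmu.integrable_mul (memLp_divergence w (-ν) _ h1 h2)).congr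
          (Eventually.of_forall fun x => ?_)
        simp only [Pi.mul_apply, smul_eq_mul]
        ring
      have i3 : Integrable (fun q : Rd d × Rd d => p.1 (q.1 + q.2) * ‖φ q.1‖ * weight w q.2)
          (volume.prod volume) := by
        have hmp : MeasurePreserving (fun p : Rd d × Rd d => (p.1 + p.2, p.2))
            (volume.prod volume) (volume.prod volume) := measurePreserving_add_prod volume volume
        have j1 : Integrable (fun q : Rd d × Rd d => ‖φ q.1‖ ^ 2 * weight w q.2)
            (volume.prod volume) := hφ.norm.integrable_sq.mul_prod w.integrable
        have j2 : Integrable (fun q : Rd d × Rd d => p.1 (q.1 + q.2) ^ 2 * weight w q.2)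
            (volume.prod volume) :=
          hmp.integrable_comp_of_integrable ((Lp.memLp p.1).integrable_sq.mul_prod w.integrable)
        have hum : AEStronglyMeasurable (fun q : Rd d × Rd d => p.1 (q.1 + q.2))
            (volume.prod volume) :=
          ((Lp.memLp p.1).aestronglyMeasurable.comp_fst (ν := volume)).comp_measurePreserving hmp
        refine (j1.add j2).mono' ?_ (Eventually.of_forall fun q => ?_)
        · exact (hum.mul (h1.continuous.comp continuous_fst).norm.aestronglyMeasurable).mul
            w.integrable.aestronglyMeasurable.comp_snd
        · simp only [Pi.add_apply]
          rw [norm_mul, ← add_mul, Real.norm_of_nonneg (weight_nonneg w q.2)]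
          refine mul_le_mul_of_nonneg_right ?_ (weight_nonneg w q.2)
          rw [norm_mul, norm_norm, ← sq_abs (p.1 (q.1 + q.2)), Real.norm_eq_abs]
          nlinarith [sq_nonneg (|p.1 (q.1 + q.2)| - ‖φ q.1‖), sq_nonneg (|p.1 (q.1 + q.2)|),
            sq_nonneg ‖φ q.1‖]
      have hin : ∀ {k : Rd d → Rd d}, MemLp k 2 volume →
          Integrable (fun x => inner ℝ (k x) (φ x)) := fun {k} hk => by
        refine (L2.integrable_inner (𝕜 := ℝ) (hk.toLp k) (hφ.toLp φ)).congr ?_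
        filter_upwards [hφ.coeFn_toLp, hk.coeFn_toLp] with x hx hx'
        rw [hx, hx']
      rw [distGradPairing_mul w hη1 hη2 (Lp.memLp p.1).aestronglyMeasurable h1 h2 i1 i2 i3,
        hp _ hηφ1 hηφ2]
      simp only [inner_add_left]
      rw [integral_add (hin hmg) (hin hmc)]
      simp only [inner_smul_left, inner_smul_right, RCLike.conj_to_real]
    refine hfun.congr_ae hmu.coeFn_toLp ((Lp.coeFn_add _ _).trans ?_)
    exact hmg.coeFn_toLp.add hmc.coeFn_toLp
  · have hI : 0 ≤ ∫ z, m z * w.toFun z :=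
      integral_nonneg fun z => mul_nonneg ((abs_nonneg _).trans (h 0 z)) (w.nonneg z)
    rw [Lp.norm_toLp, Lp.norm_def, ← ENNReal.toReal_ofReal hI, ← ENNReal.toReal_mul]
    exact ENNReal.toReal_mono
      (ENNReal.mul_lt_top ENNReal.ofReal_lt_top (Lp.memLp p.1).eLpNorm_lt_top).ne hle

/-! ### Test functions have a square integrable gradient -/

/-- Constants have zero distributional gradient. -/
lemma hasDistGrad_one (w : Kernel d) (ν : Rd d) : HasDistGrad w ν (fun _ => 1) 0 := by
  intro φ h1 h2
  have hzero : ∀ z : Rd d, ∫ x, quot (-ν) φ x z * weight w z = 0 := fun z => by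
    have hφ : Integrable φ := h1.continuous.integrable_of_hasCompactSupport h2
    have hφz : Integrable fun x => φ (x + z) := hφ.comp_add_right z
    have hsub : Integrable fun x => φ (x + z) - φ x := hφz.sub hφ
    simp only [quot]
    rw [integral_mul_const, integral_mul_const, integral_const_mul, integral_inner hsub,
      integral_sub hφz hφ, integral_add_right_eq_self φ z, sub_self, inner_zero_right]
    simp
  simp only [distGradPairing, one_mul, divergence_eq w (-ν) φ h1 h2]
  rw [integral_integral_swap (f := fun x z => quot (-ν) φ x z * weight w z)
    (integrable_prod w (-ν) φ h1 h2)]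
  simp [hzero]

lemma inner_commutator_one (w : Kernel d) (ν : Rd d) {η : Rd d → ℝ} (hη1 : ContDiff ℝ ∞ η)
    (hη2 : HasCompactSupport η) (e x : Rd d) :
    inner ℝ (commutator w ν η (fun _ => 1) x) e = divergence w ν (fun y => η y • e) x := by
  obtain ⟨C, hC0, hC⟩ := exists_abs_sub_le_min hη1 hη2
  have hint : Integrable fun z => commIntegrand w ν η (fun _ => 1) (x, z) := by
    refine (w.integrable.const_mul C).mono' ?_ (Eventually.of_forall fun z => ?_)
    · exact (w.integrable.aestronglyMeasurable.const_mul 1).smul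
        ((measurable_commKernel hη1.continuous).comp measurable_prodMk_left).aestronglyMeasurable
    · rw [commIntegrand, one_mul, norm_smul, Real.norm_of_nonneg (weight_nonneg w z)]
      refine (weight_mul_norm_commKernel_le w (hC x z)).trans (le_of_eq ?_)
      ring
  have hv1 : ContDiff ℝ ∞ fun y => η y • e := hη1.smul contDiff_const
  have hv2 : HasCompactSupport fun y => η y • e := hη2.smul_right
  rw [divergence_eq w ν _ hv1 hv2, commutator, real_inner_comm,
    ← integral_inner hint]
  refine integral_congr_ae (Eventually.of_forall fun z => ?_)
  simp only [commIntegrand, commKernel, quot, inner_smul_left, inner_smul_right, ← sub_smul,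
    RCLike.conj_to_real, real_inner_comm]
  ring

lemma memLp_commutator_one (w : Kernel d) (ν : Rd d) {η : Rd d → ℝ} (hη1 : ContDiff ℝ ∞ η)
    (hη2 : HasCompactSupport η) : MemLp (commutator w ν η fun _ => 1) 2 volume := by
  let b := EuclideanSpace.basisFun (Fin d) ℝ
  have e : commutator w ν η (fun _ => 1)
      = fun x => ∑ i, divergence w ν (fun y => η y • b i) x • b i := by
    funext x
    conv_lhs => rw [← b.sum_repr' (commutator w ν η (fun _ => 1) x)]
    refine Finset.sum_congr rfl fun i _ => ?_
    rw [real_inner_comm, inner_commutator_one w ν hη1 hη2]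
  rw [e]
  refine memLp_finsetSum _ fun i _ => ?_
  have hv1 : ContDiff ℝ ∞ fun y => η y • b i := hη1.smul contDiff_const
  have hv2 : HasCompactSupport fun y => η y • b i := hη2.smul_right
  exact (ContinuousLinearMap.toSpanSingleton ℝ (b i)).comp_memLp' (memLp_divergence w ν _ hv1 hv2)

/-- Every test function has a distributional gradient in `L²`: the Leibniz rule for `η = η ⬝ 1`. -/
lemma hasDistGrad_testFunction (w : Kernel d) (ν : Rd d) {η : Rd d → ℝ} (hη1 : ContDiff ℝ ∞ η)
    (hη2 : HasCompactSupport η) : HasDistGrad w ν η (commutator w ν η fun _ => 1) := by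
  intro φ h1 h2
  have hηφ1 : ContDiff ℝ ∞ fun y => η y • φ y := hη1.smul h1
  have hηφ2 : HasCompactSupport fun y => η y • φ y := h2.smul_left (f := η)
  have i1 : Integrable fun x => (1 : ℝ) * divergence w (-ν) (fun y => η y • φ y) x := by
    have := (integrable_prod w (-ν) _ hηφ1 hηφ2).integral_prod_left
    simpa only [one_mul, divergence_eq w (-ν) _ hηφ1 hηφ2] using this
  have i2 : Integrable fun x => (1 : ℝ) * (η x * divergence w (-ν) φ x) := by
    simp only [one_mul]
    have hη : MemLp η 2 volume := hη1.continuous.memLp_of_hasCompactSupport hη2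
    exact hη.integrable_mul (memLp_divergence w (-ν) _ h1 h2)
  have i3 : Integrable (fun q : Rd d × Rd d => (1 : ℝ) * ‖φ q.1‖ * weight w q.2)
      (volume.prod volume) := by
    simp only [one_mul]
    exact (h1.continuous.integrable_of_hasCompactSupport h2).norm.mul_prod w.integrable
  have key := distGradPairing_mul w (ν := ν) hη1 hη2 aestronglyMeasurable_const h1 h2 i1 i2 i3
  rw [hasDistGrad_one w ν _ hηφ1 hηφ2] at key
  simpa using key

/-! ### Cutoff at infinity -/

lemma tendsto_of_ae_eq_smul {E : Type*} [NormedAddCommGroup E] [NormedSpace ℝ E]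
    {η : ℕ → Rd d → ℝ} (hη : ∀ n x, η n x ∈ Set.Icc (0 : ℝ) 1)
    (hlim : ∀ x, Tendsto (fun n => η n x) atTop (𝓝 1)) {f : L2 d E} {F : ℕ → L2 d E}
    (hηm : ∀ n, Continuous (η n)) (hF : ∀ n, F n =ᵐ[volume] fun x => η n x • f x) :
    Tendsto F atTop (𝓝 f) := by
  rw [Lp.tendsto_Lp_iff_tendsto_eLpNorm']
  have e : ∀ n, eLpNorm (⇑(F n) - ⇑f) 2 volume
      = (∫⁻ x, ‖(η n x - 1) • f x‖ₑ ^ (2 : ℝ)) ^ (1 / 2 : ℝ) := fun n => by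
    rw [eLpNorm_eq_lintegral_rpow_enorm_toReal (by norm_num) (by norm_num)]
    simp only [ENNReal.toReal_ofNat]
    congr 1
    refine lintegral_congr_ae ?_
    filter_upwards [hF n] with x hx
    rw [Pi.sub_apply, hx, sub_smul, one_smul]
  simp only [e]
  have hf := (Lp.memLp f).aestronglyMeasurable
  have hfin : ∫⁻ x, ‖f x‖ₑ ^ (2 : ℝ) ≠ ⊤ := by
    have := lintegral_rpow_enorm_lt_top_of_eLpNorm_lt_top (by norm_num) (by norm_num)
      (Lp.memLp f).eLpNorm_lt_top
    simpa using this.ne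
  have h0 : Tendsto (fun n => ∫⁻ x, ‖(η n x - 1) • f x‖ₑ ^ (2 : ℝ)) atTop
      (𝓝 (∫⁻ _ : Rd d, 0)) := by
    refine tendsto_lintegral_of_dominated_convergence' (fun x => ‖f x‖ₑ ^ (2 : ℝ)) (fun n => ?_)
      (fun n => Eventually.of_forall fun x => ?_) hfin (Eventually.of_forall fun x => ?_)
    · exact ((((hηm n).sub continuous_const).aestronglyMeasurable.smul hf).enorm).pow_const 2
    · refine ENNReal.rpow_le_rpow ?_ (by norm_num)
      rw [← ofReal_norm, ← ofReal_norm]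
      refine ENNReal.ofReal_le_ofReal ?_
      rw [norm_smul]
      refine mul_le_of_le_one_left (norm_nonneg _) ?_
      rw [Real.norm_eq_abs, abs_le]
      constructor <;> linarith [(hη n x).1, (hη n x).2]
    · have h1 : Tendsto (fun n => (η n x - 1) • f x) atTop (𝓝 0) := by
        simpa using ((hlim x).sub_const 1).smul_const (f x)
      have h2 := (h1.enorm).ennrpow_const 2
      simpa using h2
  simpa using h0.ennrpow_const (1 / 2)

/-- Pairs in the graph are limits of their cutoffs at infinity. -/
lemma exists_tendsto_compactSupport {w : Kernel d} {ν : Rd d} {p : L2 d ℝ × L2 d (Rd d)}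
    (hp : p ∈ gradGraph w ν) :
    ∃ q : ℕ → L2 d ℝ × L2 d (Rd d), Tendsto q atTop (𝓝 p) ∧ ∀ n, q n ∈ gradGraph w ν ∧
      (∃ K, IsCompact K ∧ ∀ᵐ x, x ∉ K → (q n).1 x = 0) ∧ ∀ᵐ x, p.1 x = 0 → (q n).1 x = 0 := by
  let η : ContDiffBump (0 : Rd d) := ⟨1, 2, one_pos, one_lt_two⟩
  obtain ⟨C, hC0, hC⟩ := exists_abs_sub_le_min (d := d) (η := η) η.contDiff η.hasCompactSupport
  have hs : ∀ n : ℕ, (0 : ℝ) < ((n : ℝ) + 1)⁻¹ := fun n => by positivity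
  have hs1 : ∀ n : ℕ, ((n : ℝ) + 1)⁻¹ ≤ 1 := fun n =>
    inv_le_one_of_one_le₀ (by linarith [n.cast_nonneg (α := ℝ)])
  have hs0 : Tendsto (fun n : ℕ => ((n : ℝ) + 1)⁻¹) atTop (𝓝 0) := by
    simpa using tendsto_one_div_add_atTop_nhds_zero_nat (𝕜 := ℝ)
  let ηs : ℕ → Rd d → ℝ := fun n x => η (((n : ℝ) + 1)⁻¹ • x)
  let m : ℕ → Rd d → ℝ := fun n z => C * min 1 (((n : ℝ) + 1)⁻¹ * ‖z‖)
  have hη1 : ∀ n, ContDiff ℝ ∞ (ηs n) := fun n => η.contDiff.comp (contDiff_const_smul _)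
  have hη2 : ∀ n, HasCompactSupport (ηs n) := fun n =>
    η.hasCompactSupport.comp_homeomorph (Homeomorph.smulOfNeZero _ (hs n).ne')
  have hmod : ∀ n x z, |ηs n (x + z) - ηs n x| ≤ m n z := fun n x z => by
    have := hC (((n : ℝ) + 1)⁻¹ • x) (((n : ℝ) + 1)⁻¹ • z)
    rwa [norm_smul, Real.norm_of_nonneg (hs n).le, ← smul_add] at this
  have hmle : ∀ n z, ‖m n z * w.toFun z‖ ≤ C * weight w z := fun n z => by
    have h0 : 0 ≤ min 1 (((n : ℝ) + 1)⁻¹ * ‖z‖) := le_min zero_le_one (by positivity)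
    rw [Real.norm_of_nonneg (mul_nonneg (mul_nonneg hC0 h0) (w.nonneg z)), weight, ← mul_assoc]
    refine mul_le_mul_of_nonneg_right (mul_le_mul_of_nonneg_left ?_ hC0) (w.nonneg z)
    exact min_le_min_left _ (mul_le_of_le_one_left (norm_nonneg z) (hs1 n))
  have hmm : ∀ n, AEStronglyMeasurable (fun z => m n z * w.toFun z) volume := fun n => by
    -- away from the null set `{0}` the weight can be divided out
    have hk : AEStronglyMeasurable (fun z => m n z * (min 1 ‖z‖)⁻¹ * weight w z) volume := by
      refine AEStronglyMeasurable.mul ?_ w.integrable.aestronglyMeasurable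
      have : Measurable fun z : Rd d => m n z * (min 1 ‖z‖)⁻¹ := by fun_prop
      exact this.aestronglyMeasurable
    refine hk.congr (Eventually.of_forall fun z => ?_)
    by_cases hz : z = 0
    · simp [hz, m]
    · have : min 1 ‖z‖ ≠ 0 := (lt_min one_pos (norm_pos_iff.2 hz)).ne'
      simp only [weight]
      field_simp
  have hmi : ∀ n, Integrable (fun z => m n z * w.toFun z) := fun n =>
    (w.integrable.const_mul C).mono' (hmm n) (Eventually.of_forall (hmle n))
  have hI : Tendsto (fun n => ∫ z, m n z * w.toFun z) atTop (𝓝 0) := by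
    have := tendsto_integral_of_dominated_convergence (μ := (volume : Measure (Rd d)))
      (F := fun n z => m n z * w.toFun z) (f := fun _ => 0) _ hmm
      (w.integrable.const_mul C) (fun n => Eventually.of_forall (hmle n))
      (Eventually.of_forall fun z => ?_)
    · simpa using this
    · have h1 : Tendsto (fun n : ℕ => ((n : ℝ) + 1)⁻¹ * ‖z‖) atTop (𝓝 0) := by
        simpa using hs0.mul_const ‖z‖
      have h2 := (((tendsto_const_nhds (x := (1 : ℝ))).min h1).const_mul C).mul_const (w.toFun z)
      simpa using h2
  choose u g c hmem hu hg hc using fun n =>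
    exists_mul_mem_gradGraph (w := w) (ν := ν) (hη1 n) (hη2 n) (hmi n) (hmod n) hp
  have hIcc : ∀ n x, ηs n x ∈ Set.Icc (0 : ℝ) 1 := fun n x => ⟨η.nonneg, η.le_one⟩
  have hlim : ∀ x, Tendsto (fun n => ηs n x) atTop (𝓝 1) := fun x => by
    have h1 : Tendsto (fun n : ℕ => ((n : ℝ) + 1)⁻¹ • x) atTop (𝓝 0) := by
      simpa using hs0.smul_const x
    have h2 := (η.continuous.tendsto 0).comp h1
    rwa [η.eventuallyEq_one.eq_of_nhds] at h2
  have hc0 : Tendsto c atTop (𝓝 0) := by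
    refine squeeze_zero_norm hc ?_
    simpa using hI.mul_const ‖p.1‖
  refine ⟨fun n => (u n, g n + c n), ?_, fun n => ⟨hmem n, ⟨tsupport (ηs n), hη2 n, ?_⟩, ?_⟩⟩
  · have h1 := tendsto_of_ae_eq_smul hIcc hlim (fun n => (hη1 n).continuous) hu
    have h2 := tendsto_of_ae_eq_smul hIcc hlim (fun n => (hη1 n).continuous) hg
    have h3 := h1.prodMk_nhds (h2.add hc0)
    simpa using h3
  · filter_upwards [hu n] with x hx hxK
    rw [hx, image_eq_zero_of_notMem_tsupport hxK, zero_smul]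
  · filter_upwards [hu n] with x hx hx0
    rw [hx, hx0, smul_zero]

end L2Graph

/-! ### Pushing compact pieces of a domain into its interior -/

/-- Near each point, `Ω` can be pushed into its interior: there is a direction `e` such that small
translates in this direction of the part of `Ω` in a compact subset of the ball lie in a compact
subset of `Ω`. The direction is upwards at the boundary of an epigraph, and `e = 0` will do at
interior points. -/
def HasInwardDirections {d : ℕ} (Ω : Set (Rd d)) : Prop :=
  ∀ x₀, ∃ r > 0, ∃ e : Rd d, ∀ K ⊆ Metric.ball x₀ r, IsCompact K →
    ∀ᶠ t : ℝ in 𝓝[>] 0, ∃ K' ⊆ Ω, IsCompact K' ∧ ∀ x ∈ Ω ∩ K, x + t • e ∈ K'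

section Geometry

variable {n : ℕ}

lemma continuous_graph_projection :
    Continuous fun x : Rd (n + 1) => (WithLp.toLp 2 fun i : Fin n => x i.castSucc : Rd n) :=
  (PiLp.continuous_toLp 2 _).comp (by fun_prop)

lemma isOpen_aboveGraph {ζ : Rd n → ℝ} (hζ : Continuous ζ) : IsOpen (aboveGraph ζ) :=
  isOpen_lt (hζ.comp continuous_graph_projection) (by fun_prop)

lemma IsEpigraph.isOpen {E : Set (Rd (n + 1))} (hE : IsEpigraph E) : IsOpen E := by
  obtain ⟨T, ζ, hζ, rfl⟩ := hE
  exact (isOpen_aboveGraph hζ).preimage T.continuous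

/-- Moving upwards, the closure of an epigraph is mapped into the epigraph. -/
lemma IsEpigraph.exists_direction {E : Set (Rd (n + 1))} (hE : IsEpigraph E) :
    ∃ e : Rd (n + 1), ∀ x ∈ closure E, ∀ t : ℝ, 0 < t → x + t • e ∈ E := by
  obtain ⟨T, ζ, hζ, rfl⟩ := hE
  let e₀ : Rd (n + 1) := EuclideanSpace.single (Fin.last n) 1
  refine ⟨T.linearIsometryEquiv.symm e₀, fun x hx t ht => ?_⟩
  have hcl : closure (T ⁻¹' aboveGraph ζ) ⊆
      {x | ζ (WithLp.toLp 2 fun i : Fin n => T x i.castSucc) ≤ T x (Fin.last n)} := by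
    refine closure_minimal ?_ ?_
    · intro y hy
      change ζ (WithLp.toLp 2 fun i : Fin n => T y i.castSucc) < T y (Fin.last n) at hy
      exact hy.le
    exact isClosed_le (hζ.comp (continuous_graph_projection.comp T.continuous))
      ((by fun_prop : Continuous fun y : Rd (n + 1) => y (Fin.last n)).comp T.continuous)
  have hTx : T (x + t • T.linearIsometryEquiv.symm e₀) = T x + t • e₀ := by
    have := T.map_vadd x (t • T.linearIsometryEquiv.symm e₀)
    rwa [map_smul, LinearIsometryEquiv.apply_symm_apply, vadd_eq_add, vadd_eq_add,
      add_comm _ x, add_comm _ (T x)] at this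
  change T (x + t • T.linearIsometryEquiv.symm e₀) ∈ aboveGraph ζ
  rw [hTx]
  have hproj : (fun i : Fin n => (T x + t • e₀) i.castSucc) = fun i => T x i.castSucc := by
    funext i
    simp [e₀, (Fin.castSucc_lt_last i).ne]
  have hlast : (T x + t • e₀) (Fin.last n) = T x (Fin.last n) + t := by simp [e₀]
  change ζ (WithLp.toLp 2 fun i : Fin n => (T x + t • e₀) i.castSucc) < (T x + t • e₀) (Fin.last n)
  rw [hproj, hlast]
  have : ζ (WithLp.toLp 2 fun i : Fin n => T x i.castSucc) ≤ T x (Fin.last n) := hcl hx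
  linarith

lemma exists_inward_of_epigraph {Ω E : Set (Rd (n + 1))} (hE : IsEpigraph E) {x₀ : Rd (n + 1)}
    {r : ℝ} (h : Ω ∩ Metric.ball x₀ r = E ∩ Metric.ball x₀ r) :
    ∃ e : Rd (n + 1), ∀ K ⊆ Metric.ball x₀ r, IsCompact K →
      ∀ᶠ t : ℝ in 𝓝[>] 0, ∃ K' ⊆ Ω, IsCompact K' ∧ ∀ x ∈ Ω ∩ K, x + t • e ∈ K' := by
  obtain ⟨e, he⟩ := hE.exists_direction
  refine ⟨e, fun K hKB hK => ?_⟩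
  obtain ⟨δ, hδ, hδB⟩ := hK.exists_cthickening_subset_open Metric.isOpen_ball hKB
  have hsmall : ∀ᶠ t : ℝ in 𝓝[>] 0, ‖t • e‖ < δ := by
    have hc : Tendsto (fun t : ℝ => ‖t • e‖) (𝓝 0) (𝓝 0) := by
      simpa using (Continuous.tendsto (f := fun t : ℝ => ‖t • e‖) (by fun_prop) 0)
    exact (hc.mono_left nhdsWithin_le_nhds).eventually_lt_const hδ
  filter_upwards [hsmall, self_mem_nhdsWithin] with t ht ht0
  refine ⟨(fun x => x + t • e) '' (closure E ∩ K), ?_,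
    (hK.inter_left isClosed_closure).image (by fun_prop), ?_⟩
  · rintro _ ⟨x, ⟨hxE, hxK⟩, rfl⟩
    have hB : x + t • e ∈ Metric.ball x₀ r :=
      hδB (Metric.mem_cthickening_of_dist_le _ x _ _ hxK (by simpa [dist_eq_norm] using ht.le))
    exact (h.symm ▸ (⟨he x hxE t ht0, hB⟩ : x + t • e ∈ E ∩ Metric.ball x₀ r) :
      x + t • e ∈ Ω ∩ Metric.ball x₀ r).1
  · rintro x ⟨hxΩ, hxK⟩
    have hxE : x ∈ E ∩ Metric.ball x₀ r := h ▸ ⟨hxΩ, hKB hxK⟩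
    exact ⟨x, ⟨subset_closure hxE.1, hxK⟩, rfl⟩

lemma IsEpigraph.hasInwardDirections {Ω : Set (Rd (n + 1))} (hΩ : IsEpigraph Ω) :
    HasInwardDirections Ω := fun x₀ =>
  ⟨1, one_pos, exists_inward_of_epigraph hΩ (x₀ := x₀) (r := 1) rfl⟩

lemma HasContinuousBoundary.hasInwardDirections {Ω : Set (Rd (n + 1))} (hΩ : IsOpen Ω)
    (hb : HasContinuousBoundary Ω) : HasInwardDirections Ω := by
  intro x₀
  by_cases hfr : x₀ ∈ frontier Ω
  · obtain ⟨r, hr, E, hE, h⟩ := hb x₀ hfr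
    exact ⟨r, hr, exists_inward_of_epigraph hE h⟩
  by_cases hx : x₀ ∈ Ω
  · obtain ⟨r, hr, hrΩ⟩ := Metric.isOpen_iff.1 hΩ x₀ hx
    refine ⟨r, hr, 0, fun K hKB hK => Eventually.of_forall fun t =>
      ⟨K, hKB.trans hrΩ, hK, fun x hxK => ?_⟩⟩
    simpa using hxK.2
  · have hcl : x₀ ∈ (closure Ω)ᶜ := fun hc => hfr ⟨hc, fun hi => hx (interior_subset hi)⟩
    obtain ⟨r, hr, hrΩ⟩ := Metric.isOpen_iff.1 isClosed_closure.isOpen_compl x₀ hcl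
    refine ⟨r, hr, 0, fun K hKB _ => Eventually.of_forall fun t =>
      ⟨∅, Set.empty_subset _, isCompact_empty, fun x hxK => ?_⟩⟩
    exact (hrΩ (hKB hxK.2) (subset_closure hxK.1)).elim

end Geometry

/-! ### Density -/

section Density

variable {d : ℕ} {w : Kernel d} {ν : Rd d} {Ω : Set (Rd d)}

/-- Density for pairs supported in a small ball: translate the support into the interior of `Ω`. -/
lemma mem_closure_testPairs_of_translate (hΩ : IsOpen Ω) {K : Set (Rd d)} {e : Rd d}
    (he : ∀ᶠ t : ℝ in 𝓝[>] 0, ∃ K' ⊆ Ω, IsCompact K' ∧ ∀ x ∈ Ω ∩ K, x + t • e ∈ K')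
    {p : L2 d ℝ × L2 d (Rd d)} (hp : p ∈ gradGraph w ν)
    (h0 : ∀ᵐ x, x ∉ Ω ∩ K → p.1 x = 0) : p ∈ (testPairs w ν Ω).topologicalClosure := by
  have hlim : Tendsto (fun t : ℝ => (translate (t • e) p.1, translate (t • e) p.2)) (𝓝[>] 0)
      (𝓝 p) := by
    have hc : Continuous fun t : ℝ => (translate (t • e) p.1, translate (t • e) p.2) :=
      ((continuous_translate p.1).prodMk (continuous_translate p.2)).comp (by fun_prop)
    have := (hc.tendsto 0).mono_left (nhdsWithin_le_nhds (s := Set.Ioi (0 : ℝ)))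
    simpa [translate_zero] using this
  refine (testPairs w ν Ω).isClosed_topologicalClosure.mem_of_tendsto hlim ?_
  filter_upwards [he] with t ⟨K', hK'Ω, hK', hmap⟩
  refine mem_closure_testPairs_of_compact hΩ hK' hK'Ω (translate_mem_gradGraph hp _) ?_
  have h0' :=
    (measurePreserving_sub_right (volume : Measure (Rd d)) (t • e)).quasiMeasurePreserving.ae h0
  filter_upwards [coeFn_translate (t • e) p.1, h0'] with x hx hx0 hxK'
  rw [hx]
  refine hx0 fun hmem => hxK' ?_
  simpa using hmap _ hmem

/-- Density for pairs of bounded support: peel off the balls of a finite cover one by one, with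
`u = ηu + (1 - η)u` for a bump function `η` that is `1` on the ball removed. -/
lemma mem_closure_testPairs_of_finite_cover (hΩ : IsOpen Ω) {r : Rd d → ℝ} {e : Rd d → Rd d}
    (hr : ∀ x, 0 < r x) (he : ∀ x, ∀ K ⊆ Metric.ball x (r x), IsCompact K →
      ∀ᶠ t : ℝ in 𝓝[>] 0, ∃ K' ⊆ Ω, IsCompact K' ∧ ∀ y ∈ Ω ∩ K, y + t • e x ∈ K')
    (s : Finset (Rd d)) {p : L2 d ℝ × L2 d (Rd d)} (hp : p ∈ gradGraph w ν)
    (hpΩ : ∀ᵐ x, x ∉ Ω → p.1 x = 0)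
    (hps : ∀ᵐ x, x ∉ ⋃ a ∈ s, Metric.ball a (r a / 2) → p.1 x = 0) :
    p ∈ (testPairs w ν Ω).topologicalClosure := by
  classical
  induction s using Finset.induction_on generalizing p with
  | empty =>
    exact mem_closure_testPairs_of_compact hΩ isCompact_empty (Set.empty_subset _) hp
      (by simpa using hps)
  | insert a s _ ih =>
    let η : ContDiffBump a := ⟨r a / 2, 3 * r a / 4, half_pos (hr a), by linarith [hr a]⟩
    have hη1 : ContDiff ℝ ∞ η := η.contDiff
    obtain ⟨C, -, hC⟩ := exists_abs_sub_le_min hη1 η.hasCompactSupport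
    have hm : Integrable fun z => C * min 1 ‖z‖ * w.toFun z := by
      simpa only [mul_assoc] using w.integrable.const_mul C
    obtain ⟨u, g, c, hq, hu, -, -⟩ :=
      exists_mul_mem_gradGraph hη1 η.hasCompactSupport hm hC hp
    have hq' : (u, g + c) ∈ (testPairs w ν Ω).topologicalClosure := by
      refine mem_closure_testPairs_of_translate hΩ (he a (Metric.closedBall a (3 * r a / 4))
        (Metric.closedBall_subset_ball (by linarith [hr a])) (isCompact_closedBall _ _)) hq ?_
      filter_upwards [hu, hpΩ] with x hx hxΩ hxn
      rw [hx]
      by_cases h : x ∈ Ω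
      · rw [η.zero_of_le_dist (le_of_lt (by simpa [h] using hxn)), zero_smul]
      · rw [hxΩ h, smul_zero]
    have hrest : p - (u, g + c) ∈ (testPairs w ν Ω).topologicalClosure := by
      have hsub : ((p - (u, g + c)).1 : L2 d ℝ) =ᵐ[volume] fun x => (1 - η x) * p.1 x := by
        filter_upwards [Lp.coeFn_sub p.1 u, hu] with x h1 h2
        rw [Prod.fst_sub, h1, Pi.sub_apply, h2, smul_eq_mul]
        ring
      refine ih (sub_mem hp hq) ?_ ?_
      · filter_upwards [hsub, hpΩ] with x h1 h2 hx
        rw [h1, h2 hx, mul_zero]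
      · filter_upwards [hsub, hps] with x h1 h2 hx
        rw [h1]
        by_cases hxa : x ∈ Metric.ball a (r a / 2)
        · rw [η.one_of_mem_closedBall (Metric.ball_subset_closedBall hxa), sub_self, zero_mul]
        · rw [h2, mul_zero]
          rw [Finset.set_biUnion_insert]
          exact fun h => h.elim hxa hx
    simpa using add_mem hrest hq'

lemma HasInwardDirections.mem_closure_testPairs (hΩ : IsOpen Ω) (hd : HasInwardDirections Ω)
    {p : L2 d ℝ × L2 d (Rd d)} (hp : p ∈ gradGraph w ν) (hpΩ : ∀ᵐ x, x ∉ Ω → p.1 x = 0) :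
    p ∈ (testPairs w ν Ω).topologicalClosure := by
  choose r hr e he using hd
  obtain ⟨q, hq, hqn⟩ := exists_tendsto_compactSupport hp
  refine (testPairs w ν Ω).isClosed_topologicalClosure.mem_of_tendsto hq
    (Eventually.of_forall fun n => ?_)
  obtain ⟨hmem, ⟨K, hK, hK0⟩, hp0⟩ := hqn n
  obtain ⟨s, -, hs⟩ := hK.elim_nhds_subcover (fun x => Metric.ball x (r x / 2))
    fun x _ => Metric.ball_mem_nhds x (half_pos (hr x))
  refine mem_closure_testPairs_of_finite_cover hΩ hr he s hmem ?_ ?_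
  · filter_upwards [hpΩ, hp0] with x h1 h2 hx using h2 (h1 hx)
  · filter_upwards [hK0] with x h1 hx using h1 fun hxK => hx (hs hxK)

end Density

/-! ### From pairs in `L²` to the Sobolev space -/

section SobolevSpace

variable {d : ℕ} (w : Kernel d) (ν : Rd d) (Ω : Set (Rd d))

lemma Sobolev.exists_of_testFunctions {φ : Rd d → ℝ} (hφ : φ ∈ testFunctions Ω) :
    ∃ u : Sobolev w ν Ω, Sobolev.toL2 w ν Ω u =ᵐ[volume] φ := by
  obtain ⟨h1, h2, h3⟩ := hφ
  have hm : MemLp φ 2 (volume : Measure (Rd d)) := h1.continuous.memLp_of_hasCompactSupport h2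
  have hg := memLp_commutator_one w ν h1 h2
  refine ⟨⟨hm.toLp φ, ?_, hg.toLp _, ?_⟩, hm.coeFn_toLp⟩
  · filter_upwards [hm.coeFn_toLp] with x hx hxΩ
    rw [hx, image_eq_zero_of_notMem_tsupport fun h => hxΩ (h3 h)]
  · exact (hasDistGrad_testFunction w ν h1 h2).congr_ae hm.coeFn_toLp hg.coeFn_toLp

lemma Sobolev.dense_testFunctions
    (h : ∀ p ∈ gradGraph w ν, (∀ᵐ x, x ∉ Ω → p.1 x = 0) →
      p ∈ (testPairs w ν Ω).topologicalClosure) :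
    Dense {u : Sobolev w ν Ω | ∃ φ ∈ testFunctions Ω, Sobolev.toL2 w ν Ω u =ᵐ[volume] φ} := by
  intro u
  have hu : (toL2 w ν Ω u, grad w ν Ω u) ∈
      closure (testPairs w ν Ω : Set (L2 d ℝ × L2 d (Rd d))) :=
    h (toL2 w ν Ω u, grad w ν Ω u) (hasDistGrad_grad w ν Ω u) u.2.1
  rw [Metric.mem_closure_iff]
  intro ε hε
  obtain ⟨q, ⟨hq, φ, hφ, hqφ⟩, hdist⟩ :=
    Metric.mem_closure_iff.1 hu (ε / 2) (half_pos hε)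
  have hq0 : ∀ᵐ x, x ∉ Ω → q.1 x = 0 := by
    filter_upwards [hqφ] with x hx hxΩ
    rw [hx, image_eq_zero_of_notMem_tsupport fun h => hxΩ (hφ.2.2 h)]
  let v : Sobolev w ν Ω := ⟨q.1, hq0, q.2, hq⟩
  have hvL : toL2 w ν Ω v = q.1 := rfl
  have hvg : grad w ν Ω v = q.2 :=
    HasDistGrad.unique (hasDistGrad_grad w ν Ω v) (show HasDistGrad w ν q.1 q.2 from hq)
  refine ⟨v, ⟨φ, hφ, hqφ⟩, ?_⟩
  rw [dist_eq_norm, norm_def, map_sub, map_sub, hvL, hvg]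
  rw [Prod.dist_eq, max_lt_iff, dist_eq_norm, dist_eq_norm] at hdist
  refine (Real.sqrt_lt' hε).2 ?_
  nlinarith [hdist.1, hdist.2, norm_nonneg (toL2 w ν Ω u - q.1), norm_nonneg (grad w ν Ω u - q.2)]

end SobolevSpace

end HalfBall

end

/-- Density of `C_c^∞(Ω)` in `S_w^ν(Ω)`: every test function belongs to the space, and the test
functions form a dense subset for its norm. -/
theorem theorem3p2 {n : ℕ} (w : HalfBall.Kernel (n + 1)) (ν : HalfBall.Rd (n + 1)) (hν : ‖ν‖ = 1)
    (Ω : Set (HalfBall.Rd (n + 1)))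
    (hΩ : (HalfBall.IsDomainSet Ω ∧ Bornology.IsBounded Ω ∧ HalfBall.HasContinuousBoundary Ω) ∨
      HalfBall.IsEpigraph Ω ∨ Ω = Set.univ) :
    (∀ φ ∈ HalfBall.testFunctions Ω,
      ∃ u : HalfBall.Sobolev w ν Ω, HalfBall.Sobolev.toL2 w ν Ω u =ᵐ[volume] φ) ∧
    Dense {u : HalfBall.Sobolev w ν Ω |
      ∃ φ ∈ HalfBall.testFunctions Ω, HalfBall.Sobolev.toL2 w ν Ω u =ᵐ[volume] φ} := by
  have hgeom : IsOpen Ω ∧ HalfBall.HasInwardDirections Ω := by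
    rcases hΩ with ⟨⟨ho, -⟩, -, hb⟩ | hE | rfl
    · exact ⟨ho, hb.hasInwardDirections ho⟩
    · exact ⟨hE.isOpen, hE.hasInwardDirections⟩
    · refine ⟨isOpen_univ, HalfBall.HasContinuousBoundary.hasInwardDirections isOpen_univ ?_⟩
      intro x hx
      simp at hx
  exact ⟨fun φ hφ => HalfBall.Sobolev.exists_of_testFunctions w ν Ω hφ,
    HalfBall.Sobolev.dense_testFunctions w ν Ω fun p hp hp0 =>
      hgeom.2.mem_closure_testPairs hgeom.1 hp hp0⟩
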